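/- Let $N\ge 3$, $r_0>0$, and let $F:[0,\infty)\to\mathbb R$ satisfy: (A1) $F$ is continuous on $[0,\infty)$, $C^1$ in a neighbourhood of $r_0^2$, $F(r_0^2)=0$ and $F'(r_0^2)<0$; (A2) there are $C>0$ and $p_0<\frac{2}{N-2}$ with $|F(s)|\le C(1+s^{p_0})$ for all $s\ge 0$. Put $V(s)=\int_s^{r_0^2}F(\tau)\,d\tau$, $a=\sqrt{-\tfrac12F'(r_0^2)}$, $v_s=2ar_0$, and let $0<c<v_s$. Let $\varphi\in C^\infty(\mathbb R)$ be odd with $\varphi(s)=s$ on $[0,2r_0]$, $0\le\varphi'\le1$ on $\mathbb R$, and $\varphi(s)=3r_0$ for $s\ge 4r_0$. Let $\mathcal D^{1,2}(\mathbb R^N)$ be the space of functions $u\in L^{2^*}(\mathbb R^N)$, $2^*=\frac{2N}{N-2}$, whose weak gradient is in $L^2(\mathbb R^N)$ (for $N\ge3$ this is the completion of $C_c^\infty(\mathbb R^N)$ for the norm $\|\nabla u\|_{L^2}$), and let $$\mathcal X=\{u\in\mathcal D^{1,2}(\mathbb R^N;\mathbb C)\;:\;\varphi^2(|r_0-u|)-r_0^2\in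 L^2(\mathbb R^N)\}.$$ Let $\mathcal Y=\{\partial_{x_1}\chi : \chi\in\mathcal D^{1,2}(\mathbb R^N;\mathbb R)\}$ and let $L$ be the linear form on $L^1(\mathbb R^N)+\mathcal Y$ given by $L(f+g)=\int_{\mathbb R^N}f\,dx$ for $f\in L^1(\mathbb R^N)$, $g\in\mathcal Y$ (it is well defined). With $\langle z_1,z_2\rangle=\mathrm{Re}(z_1\overline{z_2})$, for $u\in\mathcal X$ one has $\langle i\partial_{x_1}u,u\rangle\in L^1(\mathbb R^N)+\mathcal Y$, and one sets $$Q(u)=L(\langle i\partial_{x_1}u,u\rangle),\qquad B_c(u)=\int_{\mathbb R^N}\Big|\frac{\partial u}{\partial x_1}\Big|^2dx+c\,Q(u)+\int_{\mathbb R^N}V(|r_0-u|^2)\,dx .$$ **Lemma 6.4.** Let $v\in\mathcal X$ be such that $$\lim_{t\to0}\frac{B_c(v+tw)-B_c(v)}{t}=0\qquad\text{for every } w\in C^1_c(\mathbb R^N;\mathbb C).$$ Then $v=0$ almost everywhere on $\mathbb R^N$. -/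

import Mathlib

open MeasureTheory Filter Topology
open scoped ENNReal ContDiff

namespace TravelingWaves

/-- The Euclidean space `ℝ^N`, with Lebesgue measure `volume`. The coordinate `x₁` is the
coordinate of index `0`. -/
abbrev Space (N : ℕ) : Type := EuclideanSpace ℝ (Fin N)

section Sobolev

variable {N : ℕ} {G : Type*} [NormedAddCommGroup G] [NormedSpace ℝ G]

/-- `g` is the weak (distributional) partial derivative `∂u/∂x_i` on `ℝ^N`: both functions are
locally integrable, and `∫ (∂_i ψ) u = - ∫ ψ g` for every real test function `ψ ∈ C_c^∞(ℝ^N)`. -/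
def IsWeakPartial (i : Fin N) (u g : Space N → G) : Prop :=
  LocallyIntegrable u volume ∧ LocallyIntegrable g volume ∧
    ∀ ψ : Space N → ℝ, ContDiff ℝ ∞ ψ → HasCompactSupport ψ →
      ∫ x, (fderiv ℝ ψ x (EuclideanSpace.single i 1)) • u x = - ∫ x, ψ x • g x

open Classical in
/-- The weak partial derivative `∂u/∂x_i` (unique almost everywhere when it exists; `0` when there
is none). -/
noncomputable def weakPartial (i : Fin N) (u : Space N → G) : Space N → G :=
  if h : ∃ g, IsWeakPartial i u g then h.choose else 0

/-- The critical Sobolev exponent `2^* = 2N/(N-2)`, for `N ≥ 3`. -/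
noncomputable def sobolevExponent (N : ℕ) : ℝ≥0∞ :=
  ENNReal.ofReal (2 * (N : ℝ) / ((N : ℝ) - 2))

/-- The space `𝒟^{1,2}(ℝ^N)`, `N ≥ 3`, i.e. the functions `u ∈ L^{2^*}(ℝ^N)` whose weak gradient is
in `L²(ℝ^N)`. -/
def MemD12 (u : Space N → G) : Prop :=
  MemLp u (sobolevExponent N) volume ∧
    ∀ i : Fin N, ∃ g : Space N → G, IsWeakPartial i u g ∧ MemLp g 2 volume

end Sobolev

/-- The function `F` is continuous on `[0, ∞)`, is `C¹` in a neighbourhood of `r₀²`, and satisfies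
`F(r₀²) = 0` and `F'(r₀²) < 0`. -/
structure AssumptionA1 (r₀ : ℝ) (F : ℝ → ℝ) : Prop where
  continuousOn : ContinuousOn F (Set.Ici 0)
  contDiffAt : ContDiffAt ℝ 1 F (r₀ ^ 2)
  map_eq_zero : F (r₀ ^ 2) = 0
  deriv_neg : deriv F (r₀ ^ 2) < 0

/-- There are `C > 0` and `p₀ < 2/(N-2)` with `|F(s)| ≤ C (1 + s^{p₀})` for all `s ≥ 0`. -/
def AssumptionA2 (N : ℕ) (F : ℝ → ℝ) : Prop :=
  ∃ C p₀ : ℝ, 0 < C ∧ p₀ < 2 / ((N : ℝ) - 2) ∧ ∀ s : ℝ, 0 ≤ s → |F s| ≤ C * (1 + s ^ p₀)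

/-- The potential `V(s) = ∫_s^{r₀²} F(τ) dτ`. -/
noncomputable def potential (r₀ : ℝ) (F : ℝ → ℝ) (s : ℝ) : ℝ :=
  ∫ τ in s..(r₀ ^ 2), F τ

/-- The sound velocity `v_s = 2 a r₀`, where `a = √(-F'(r₀²)/2)`. -/
noncomputable def soundVelocity (r₀ : ℝ) (F : ℝ → ℝ) : ℝ :=
  2 * Real.sqrt (-(1 / 2) * deriv F (r₀ ^ 2)) * r₀

/-- The truncation `φ`: an odd smooth function on `ℝ` with `φ(s) = s` on `[0, 2r₀]`,
`0 ≤ φ' ≤ 1`, and `φ(s) = 3r₀` for `s ≥ 4r₀`. -/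
structure IsTruncation (r₀ : ℝ) (φ : ℝ → ℝ) : Prop where
  contDiff : ContDiff ℝ ∞ φ
  odd : ∀ s, φ (-s) = - φ s
  eq_self : ∀ s, 0 ≤ s → s ≤ 2 * r₀ → φ s = s
  deriv_nonneg : ∀ s, 0 ≤ deriv φ s
  deriv_le_one : ∀ s, deriv φ s ≤ 1
  eq_const : ∀ s, 4 * r₀ ≤ s → φ s = 3 * r₀

section Functionals

variable {N : ℕ}

/-- The energy space `𝒳 = {u ∈ 𝒟^{1,2}(ℝ^N) | φ²(|r₀ - u|) - r₀² ∈ L²(ℝ^N)}`. -/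
def MemX (r₀ : ℝ) (φ : ℝ → ℝ) (u : Space N → ℂ) : Prop :=
  MemD12 u ∧ MemLp (fun x => φ ‖(r₀ : ℂ) - u x‖ ^ 2 - r₀ ^ 2) 2 volume

variable [NeZero N]

open Classical in
/-- The linear form `L` on `L¹(ℝ^N) + 𝒴`, where `𝒴 = {∂χ/∂x₁ | χ ∈ 𝒟^{1,2}(ℝ^N)}`, given by
`L(f + ∂χ/∂x₁) = ∫ f` (for `N ≥ 3` the value does not depend on the decomposition, since a function
of `L¹ ∩ 𝒴` has integral zero). It is extended by `0` outside `L¹ + 𝒴`. -/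
noncomputable def extendedIntegral (h : Space N → ℝ) : ℝ :=
  if H : ∃ f : Space N → ℝ, Integrable f volume ∧
      ∃ χ : Space N → ℝ, MemD12 χ ∧ h =ᵐ[volume] f + weakPartial 0 χ
  then ∫ x, H.choose x else 0

/-- The momentum `Q(u) = L(⟨i ∂u/∂x₁, u⟩)`, with `⟨z₁, z₂⟩ = Re (z₁ z̄₂)` the real scalar product
of complex numbers. -/
noncomputable def momentum (u : Space N → ℂ) : ℝ :=
  extendedIntegral fun x => inner ℝ (Complex.I * weakPartial 0 u x) (u x)

/-- `B_c(u) = ∫ |∂u/∂x₁|² dx + c Q(u) + ∫ V(|r₀ - u|²) dx`. -/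
noncomputable def functionalB (r₀ : ℝ) (F : ℝ → ℝ) (c : ℝ) (u : Space N → ℂ) : ℝ :=
  (∫ x, ‖weakPartial 0 u x‖ ^ 2) + c * momentum u +
    ∫ x, potential r₀ F (‖(r₀ : ℂ) - u x‖ ^ 2)

end Functionals

end TravelingWaves

/-! The functional differentiates in `x₁` only, so its Euler-Lagrange equation is an ordinary
differential equation: `u = r₀ - v` solves `u'' = i c u' - F(|u|²) u` on almost every line parallel
to the first axis, with finite energy by Fubini (`IsWeakPartial.ae_exists_ae_eq_primitive`,
`ae_isRegularSlice`).

On one line the equation conserves an energy and an angular momentum. Finite energy fixes both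
constants, so that `|u'|² = V(|u|²)` and the angular momentum is a multiple of `|u|² - r₀²`. At a
critical point of `|u|²` these give `c² (|u|² - r₀²)² = 4 |u|² V(|u|²)`, which is impossible for
`|u|² ≠ r₀²` close to `r₀²` because `c < v_s`. Hence a slice is either constant of modulus `r₀` or
leaves a fixed neighbourhood of that circle (`IsProfile.trivial_or_exists_le`). Dimension one alone
does not exclude the second case.

The transverse variable does. Let `A` be the set of transverse positions of nontrivial slices. Each
of them costs a fixed energy, so `A` has finite measure. A trivial and a nontrivial slice stay a
fixed distance apart in sup norm, and the sup norm interpolates between the `L²` norms of a slice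
and of its derivative. Since `v` has a transverse derivative in `L²` and `∂v/∂x₁` is in `L²`, slices
depend on the transverse variable with roughly half a derivative in sup norm, which forbids jumps.
Quantitatively, a unit translation cut into many small steps moves only a null set across the
boundary of `A`. A set of finite measure invariant under a translation is null, so `∂v/∂x₁ = 0`, and
then `v = 0` because `v ∈ L^{2^*}`.

The momentum is `0` by convention outside `L¹ + 𝒴`. Rather than deciding membership, the argument
carries a factor `θ ∈ [0, 1]` in front of `c`; the velocity `c θ` is still subsonic. -/

namespace TravelingWaves

/-! ### The truncation and the potential -/

section Potential

variable {r₀ : ℝ} {φ F : ℝ → ℝ}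

lemma IsTruncation.two_mul_le (hφ : IsTruncation r₀ φ) (hr₀ : 0 < r₀) {x : ℝ} (hx : 2 * r₀ ≤ x) :
    2 * r₀ ≤ φ x := by
  have hm : Monotone φ :=
    monotone_of_deriv_nonneg (hφ.contDiff.differentiable (by simp)) hφ.deriv_nonneg
  have := hm hx
  rwa [hφ.eq_self (2 * r₀) (by positivity) le_rfl] at this

lemma IsTruncation.three_mul_sq_le (hφ : IsTruncation r₀ φ) (hr₀ : 0 < r₀) {x : ℝ}
    (hx : 2 * r₀ ≤ x) : 3 * r₀ ^ 2 ≤ |φ x ^ 2 - r₀ ^ 2| := by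
  have := hφ.two_mul_le hr₀ hx
  refine le_trans ?_ (le_abs_self _)
  nlinarith

/-- Makes the modulus converge to `r₀` when the energy density tends to `0`. The cap `3 * r₀` is
needed since the truncated quantity does not grow with `x`. -/
lemma IsTruncation.mul_min_le (hφ : IsTruncation r₀ φ) (hr₀ : 0 < r₀) {x : ℝ} (hx : 0 ≤ x) :
    r₀ * min |x - r₀| (3 * r₀) ≤ |φ x ^ 2 - r₀ ^ 2| := by
  rcases le_total x (2 * r₀) with h | h
  · rw [hφ.eq_self x hx h, show x ^ 2 - r₀ ^ 2 = (x + r₀) * (x - r₀) by ring, abs_mul,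
      abs_of_pos (by positivity : 0 < x + r₀)]
    gcongr
    · linarith
    · exact min_le_left _ _
  · calc r₀ * min |x - r₀| (3 * r₀) ≤ r₀ * (3 * r₀) := by gcongr; exact min_le_right _ _
      _ = 3 * r₀ ^ 2 := by ring
      _ ≤ _ := hφ.three_mul_sq_le hr₀ h

lemma abs_arctan_le_abs (x : ℝ) : |Real.arctan x| ≤ |x| := by
  have key : ∀ y : ℝ, 0 ≤ y → Real.arctan y ≤ y := fun y hy ↦ by
    rcases hy.eq_or_lt with rfl | hy
    · simp
    · have := Real.lt_tan (Real.arctan_pos.2 hy) (Real.arctan_lt_pi_div_two y)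
      rw [Real.tan_arctan] at this
      exact this.le
  rcases le_total 0 x with h | h
  · rw [abs_of_nonneg h, abs_of_nonneg (Real.arctan_nonneg.2 h)]
    exact key x h
  · rw [abs_of_nonpos h, abs_of_nonpos (by simpa using Real.arctan_mono h), ← Real.arctan_neg]
    exact key _ (by linarith)

/-- Like the truncation, `arctan` tames large moduli, but it is applied to `x² - r₀²` and is easy to
differentiate. The term `1 / r₀ ^ 2` serves the range `x ≥ 2 r₀`, where the left side is at most `2`
and the truncated quantity at least `3 r₀²`. -/
lemma IsTruncation.abs_arctan_le (hφ : IsTruncation r₀ φ) (hr₀ : 0 < r₀) {x : ℝ} (hx : 0 ≤ x) :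
    |Real.arctan (x ^ 2 - r₀ ^ 2)| ≤ (1 + 1 / r₀ ^ 2) * |φ x ^ 2 - r₀ ^ 2| := by
  rcases le_total x (2 * r₀) with h | h
  · rw [hφ.eq_self x hx h]
    refine (abs_arctan_le_abs _).trans (le_mul_of_one_le_left (abs_nonneg _) ?_)
    have : 0 < 1 / r₀ ^ 2 := by positivity
    linarith
  · have h1 : |Real.arctan (x ^ 2 - r₀ ^ 2)| ≤ 2 :=
      (abs_le.2 ⟨(Real.neg_pi_div_two_lt_arctan _).le, (Real.arctan_lt_pi_div_two _).le⟩).trans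
        (by linarith [Real.pi_le_four])
    have h2 := hφ.three_mul_sq_le hr₀ h
    calc _ ≤ 2 := h1
      _ ≤ (1 / r₀ ^ 2) * (3 * r₀ ^ 2) := by field_simp; norm_num
      _ ≤ (1 + 1 / r₀ ^ 2) * |φ x ^ 2 - r₀ ^ 2| := by gcongr; linarith

lemma hasDerivAt_potential (hF : Continuous F) (s : ℝ) : HasDerivAt (potential r₀ F) (-F s) s :=
  intervalIntegral.integral_hasDerivAt_left (hF.intervalIntegrable _ _)
    (hF.stronglyMeasurableAtFilter _ _) hF.continuousAt

lemma continuous_potential (hF : Continuous F) : Continuous (potential r₀ F) :=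
  continuous_iff_continuousAt.2 fun s ↦ (hasDerivAt_potential hF s).continuousAt

/-- A quadratic lower bound on the difference between the potential and the square of the angular
momentum, valid close to the vacuum when the velocity is subsonic. -/
lemma exists_sq_lt_potential (hr₀ : 0 < r₀) (hF : Continuous F) (hF0 : F (r₀ ^ 2) = 0) {F' c : ℝ}
    (hF' : HasDerivAt F F' (r₀ ^ 2)) (hc : c ^ 2 < -2 * F' * r₀ ^ 2) :
    ∃ l > 0, ∀ s, s ≠ r₀ ^ 2 → |s - r₀ ^ 2| < l →
      c ^ 2 * (s - r₀ ^ 2) ^ 2 < 4 * s * potential r₀ F s := by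
  have hr2 : 0 < r₀ ^ 2 := by positivity
  have hm : c ^ 2 / (2 * r₀ ^ 2) < -F' := by rw [div_lt_iff₀ (by positivity)]; linarith
  -- Near `r₀²` the potential is at least `κ/2 (s - r₀²)²` for any `κ < -F'`. Then `4 s V(s)`
  -- exceeds `c² (s - r₀²)²` as soon as `s > c² / (2κ)`, a threshold lying below `r₀²` by the choice
  -- of `κ`.
  obtain ⟨κ, hκ1, hκ2⟩ := exists_between hm
  have hκ : 0 < κ := lt_of_le_of_lt (by positivity) hκ1
  have hlit := hF'.isLittleO.def (show 0 < -F' - κ by linarith)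
  obtain ⟨δ, hδ, hball⟩ := Metric.eventually_nhds_iff.1 hlit
  have hsign : ∀ τ, |τ - r₀ ^ 2| < δ → κ * (τ - r₀ ^ 2) ^ 2 ≤ -F τ * (τ - r₀ ^ 2) := by
    intro τ hτ
    have h := hball (show dist τ (r₀ ^ 2) < δ by rwa [Real.dist_eq])
    rw [hF0, sub_zero, smul_eq_mul, Real.norm_eq_abs, Real.norm_eq_abs] at h
    have h2 : (F τ - (τ - r₀ ^ 2) * F') * (τ - r₀ ^ 2) ≤ (-F' - κ) * (τ - r₀ ^ 2) ^ 2 := by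
      refine (le_abs_self _).trans ?_
      rw [abs_mul, ← sq_abs (τ - r₀ ^ 2)]
      nlinarith [mul_le_mul_of_nonneg_right h (abs_nonneg (τ - r₀ ^ 2))]
    nlinarith
  have hV : ∀ s, |s - r₀ ^ 2| < δ → κ / 2 * (s - r₀ ^ 2) ^ 2 ≤ potential r₀ F s := by
    intro s hs
    have hi : ∀ a b : ℝ, ∫ τ in a..b, κ * (r₀ ^ 2 - τ) =
        κ / 2 * (a - r₀ ^ 2) ^ 2 - κ / 2 * (b - r₀ ^ 2) ^ 2 := fun a b ↦ by
      rw [intervalIntegral.integral_const_mul, intervalIntegral.integral_sub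
        (by simp) (by simp), intervalIntegral.integral_const, integral_id]
      simp only [smul_eq_mul]; ring
    rw [abs_lt] at hs
    rcases le_total s (r₀ ^ 2) with h | h
    · have := intervalIntegral.integral_mono_on (μ := volume) h
        (show IntervalIntegrable (fun τ ↦ κ * (r₀ ^ 2 - τ)) volume s (r₀ ^ 2) from
          (by fun_prop : Continuous fun τ ↦ κ * (r₀ ^ 2 - τ)).intervalIntegrable _ _)
        (hF.intervalIntegrable _ _) (fun τ hτ ↦ by
          rcases hτ.2.eq_or_lt with rfl | hlt
          · simp [hF0]
          · have := hsign τ (abs_lt.2 ⟨by linarith [hτ.1], by linarith⟩)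
            nlinarith)
      rw [hi] at this
      simpa [potential] using this
    · have := intervalIntegral.integral_mono_on (μ := volume) h (hF.intervalIntegrable _ _)
        (show IntervalIntegrable (fun τ ↦ κ * (r₀ ^ 2 - τ)) volume (r₀ ^ 2) s from
          (by fun_prop : Continuous fun τ ↦ κ * (r₀ ^ 2 - τ)).intervalIntegrable _ _)
        (fun τ hτ ↦ by
          rcases hτ.1.eq_or_lt with rfl | hlt
          · simp [hF0]
          · have := hsign τ (abs_lt.2 ⟨by linarith, by linarith [hτ.2]⟩)
            nlinarith)
      rw [hi] at this
      rw [potential, intervalIntegral.integral_symm]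
      simp at this
      linarith
  have hl : 0 < r₀ ^ 2 - c ^ 2 / (2 * κ) := by
    rw [sub_pos, div_lt_iff₀ (by positivity)]
    rw [div_lt_iff₀ (by positivity)] at hκ1
    linarith
  refine ⟨min δ (r₀ ^ 2 - c ^ 2 / (2 * κ)), lt_min hδ hl, fun s hs hsl ↦ ?_⟩
  have h1 := hV s (hsl.trans_le (min_le_left _ _))
  have h2 := abs_lt.1 (hsl.trans_le (min_le_right _ _))
  have h3 : c ^ 2 / (2 * κ) < s := by linarith [h2.1]
  have hs0 : 0 < s := lt_of_le_of_lt (by positivity) h3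
  rw [div_lt_iff₀ (by positivity)] at h3
  have h4 : 0 < (s - r₀ ^ 2) ^ 2 := by have := sub_ne_zero.2 hs; positivity
  nlinarith [mul_le_mul_of_nonneg_left h1 hs0.le]

end Potential

/-! ### Finite energy solutions of the one-dimensional travelling wave equation -/

section Profile

/-- A nonnegative integrable function on the line gets small arbitrarily far to the right. -/
lemma exists_seq_tendsto_zero_atTop {f : ℝ → ℝ} (hf : Integrable f) (h0 : ∀ s, 0 ≤ f s) :
    ∃ x : ℕ → ℝ, Tendsto x atTop atTop ∧ Tendsto (f ∘ x) atTop (𝓝 0) := by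
  have key : ∀ n : ℕ, ∃ s : ℝ, (n : ℝ) ≤ s ∧ f s ≤ 1 / ((n : ℝ) + 1) := by
    intro n
    by_contra! H
    have hi : IntegrableOn (fun _ : ℝ ↦ 1 / ((n : ℝ) + 1)) (Set.Ici (n : ℝ)) := by
      refine Integrable.mono' hf.integrableOn aestronglyMeasurable_const ?_
      refine (ae_restrict_iff' measurableSet_Ici).2 (ae_of_all _ fun s hs ↦ ?_)
      rw [Real.norm_of_nonneg (by positivity)]
      exact (H s hs).le
    rw [integrableOn_const_iff (by simp)] at hi
    rcases hi with hi | hi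
    · rw [enorm_eq_zero] at hi
      exact absurd hi (by positivity)
    · simp at hi
  choose x hx1 hx2 using key
  refine ⟨x, tendsto_atTop_mono hx1 tendsto_natCast_atTop_atTop, ?_⟩
  exact squeeze_zero (fun n ↦ h0 _) hx2 tendsto_one_div_add_atTop_nhds_zero_nat

lemma exists_seq_tendsto_zero_atBot {f : ℝ → ℝ} (hf : Integrable f) (h0 : ∀ s, 0 ≤ f s) :
    ∃ x : ℕ → ℝ, Tendsto x atTop atBot ∧ Tendsto (f ∘ x) atTop (𝓝 0) := by
  obtain ⟨x, hx, hfx⟩ := exists_seq_tendsto_zero_atTop hf.comp_neg fun s ↦ h0 (-s)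
  exact ⟨fun n ↦ -x n, tendsto_neg_atTop_atBot.comp hx, hfx⟩

/-- `a + i b` solves `u'' = i c u' - F(|u|²) u`, with derivative `a' + i b'`. -/
structure IsProfile (F : ℝ → ℝ) (c : ℝ) (a b a' b' : ℝ → ℝ) : Prop where
  hasDerivAt_re : ∀ s, HasDerivAt a (a' s) s
  hasDerivAt_im : ∀ s, HasDerivAt b (b' s) s
  hasDerivAt_re' : ∀ s, HasDerivAt a' (-(c * b' s) - F (a s ^ 2 + b s ^ 2) * a s) s
  hasDerivAt_im' : ∀ s, HasDerivAt b' (c * a' s - F (a s ^ 2 + b s ^ 2) * b s) s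

variable {r₀ c : ℝ} {φ F a b a' b' : ℝ → ℝ}

lemma eq_of_hasDerivAt_eq_zero {f : ℝ → ℝ} (hf : ∀ s, HasDerivAt f 0 s) (s t : ℝ) : f s = f t :=
  is_const_of_deriv_eq_zero (fun s ↦ (hf s).differentiableAt) (fun s ↦ (hf s).deriv) s t

lemma IsProfile.hasDerivAt_sq (h : IsProfile F c a b a' b') (s : ℝ) :
    HasDerivAt (fun s ↦ a s ^ 2 + b s ^ 2) (2 * (a s * a' s + b s * b' s)) s :=
  (((h.hasDerivAt_re s).pow 2).add ((h.hasDerivAt_im s).pow 2)).congr_deriv (by simp; ring)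

/-- Pair the equation with `u'`: the term `i c u'` is orthogonal to it. -/
lemma IsProfile.energy_eq (h : IsProfile F c a b a' b') (hF : Continuous F) (s t : ℝ) :
    a' s ^ 2 + b' s ^ 2 - potential r₀ F (a s ^ 2 + b s ^ 2) =
      a' t ^ 2 + b' t ^ 2 - potential r₀ F (a t ^ 2 + b t ^ 2) :=
  eq_of_hasDerivAt_eq_zero
    (f := fun s ↦ a' s ^ 2 + b' s ^ 2 - potential r₀ F (a s ^ 2 + b s ^ 2)) (fun s ↦
    ((((h.hasDerivAt_re' s).pow 2).add ((h.hasDerivAt_im' s).pow 2)).sub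
      ((hasDerivAt_potential hF _).comp s (h.hasDerivAt_sq s))).congr_deriv (by simp; ring)) s t

/-- Pair the equation with `i u`: the force is radial and drops out, and the term in `c` is an exact
derivative. -/
lemma IsProfile.momentum_eq (h : IsProfile F c a b a' b') (s t : ℝ) :
    a' s * b s - b' s * a s + c / 2 * (a s ^ 2 + b s ^ 2) =
      a' t * b t - b' t * a t + c / 2 * (a t ^ 2 + b t ^ 2) :=
  eq_of_hasDerivAt_eq_zero
    (f := fun s ↦ a' s * b s - b' s * a s + c / 2 * (a s ^ 2 + b s ^ 2)) (fun s ↦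
    ((((h.hasDerivAt_re' s).mul (h.hasDerivAt_im s)).sub
      ((h.hasDerivAt_im' s).mul (h.hasDerivAt_re s))).add
      ((h.hasDerivAt_sq s).const_mul (c / 2))).congr_deriv (by ring)) s t

/-- Along a sequence where the energy density tends to `0`, the modulus tends to `r₀`. -/
lemma tendsto_sq_add_sq (hφ : IsTruncation r₀ φ) (hr₀ : 0 < r₀) {x : ℕ → ℝ}
    (hx : Tendsto ((fun s ↦ a' s ^ 2 + b' s ^ 2 +
      (φ √(a s ^ 2 + b s ^ 2) ^ 2 - r₀ ^ 2) ^ 2) ∘ x) atTop (𝓝 0)) :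
    Tendsto (fun n ↦ a (x n) ^ 2 + b (x n) ^ 2) atTop (𝓝 (r₀ ^ 2)) ∧
      Tendsto (fun n ↦ a' (x n)) atTop (𝓝 0) ∧ Tendsto (fun n ↦ b' (x n)) atTop (𝓝 0) := by
  have aux : ∀ f : ℝ → ℝ, (∀ s, f s ^ 2 ≤ a' s ^ 2 + b' s ^ 2 +
      (φ √(a s ^ 2 + b s ^ 2) ^ 2 - r₀ ^ 2) ^ 2) → Tendsto (fun n ↦ |f (x n)|) atTop (𝓝 0) := by
    intro f hf
    have h1 : Tendsto (fun n ↦ f (x n) ^ 2) atTop (𝓝 0) :=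
      squeeze_zero (fun n ↦ sq_nonneg _) (fun n ↦ hf (x n)) hx
    have h2 := (Real.continuous_sqrt.tendsto 0).comp h1
    simpa [Function.comp_def, Real.sqrt_sq_eq_abs] using h2
  have ha := aux a' fun s ↦ by
    nlinarith [sq_nonneg (b' s), sq_nonneg (φ √(a s ^ 2 + b s ^ 2) ^ 2 - r₀ ^ 2)]
  have hb := aux b' fun s ↦ by
    nlinarith [sq_nonneg (a' s), sq_nonneg (φ √(a s ^ 2 + b s ^ 2) ^ 2 - r₀ ^ 2)]
  refine ⟨?_, (tendsto_zero_iff_abs_tendsto_zero _).2 ha,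
    (tendsto_zero_iff_abs_tendsto_zero _).2 hb⟩
  have h1 := aux (fun s ↦ φ √(a s ^ 2 + b s ^ 2) ^ 2 - r₀ ^ 2) fun s ↦ by
    nlinarith [sq_nonneg (a' s), sq_nonneg (b' s)]
  have h2 : Tendsto (fun n ↦ min |√(a (x n) ^ 2 + b (x n) ^ 2) - r₀| (3 * r₀)) atTop (𝓝 0) := by
    refine squeeze_zero (fun n ↦ by positivity) (fun n ↦ ?_)
      (by simpa using h1.const_mul (1 / r₀))
    have := hφ.mul_min_le hr₀ (Real.sqrt_nonneg (a (x n) ^ 2 + b (x n) ^ 2))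
    rw [inv_mul_eq_div, le_div_iff₀ hr₀]
    linarith
  have h3 : Tendsto (fun n ↦ |√(a (x n) ^ 2 + b (x n) ^ 2) - r₀|) atTop (𝓝 0) := by
    refine h2.congr' ?_
    filter_upwards [h2.eventually (gt_mem_nhds (show 0 < 3 * r₀ by positivity))] with n hn
    rcases min_lt_iff.1 hn with h | h
    · exact min_eq_left h.le
    · exact absurd h (lt_irrefl _)
  have h4 := ((tendsto_zero_iff_abs_tendsto_zero _).2 h3).add_const r₀
  simp only [sub_add_cancel, zero_add] at h4
  exact (h4.pow 2).congr fun n ↦ Real.sq_sqrt (by positivity)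

/-- The conserved quantities are evaluated along a sequence on which the energy density tends to
`0`: there `|u|² → r₀²` and `u' → 0`, while `V(r₀²) = 0`. -/
lemma IsProfile.first_integrals
    (h : IsProfile F c a b a' b') (hF : Continuous F) (hφ : IsTruncation r₀ φ) (hr₀ : 0 < r₀)
    (hE : Integrable fun s ↦ a' s ^ 2 + b' s ^ 2 + (φ √(a s ^ 2 + b s ^ 2) ^ 2 - r₀ ^ 2) ^ 2) (s : ℝ) :
    a' s ^ 2 + b' s ^ 2 = potential r₀ F (a s ^ 2 + b s ^ 2) ∧
      a' s * b s - b' s * a s = -(c / 2 * (a s ^ 2 + b s ^ 2 - r₀ ^ 2)) := by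
  obtain ⟨x, -, hx⟩ := exists_seq_tendsto_zero_atTop hE fun s ↦ by positivity
  obtain ⟨h1, h2, h3⟩ := tendsto_sq_add_sq hφ hr₀ hx
  have ha : Tendsto (fun n ↦ a' (x n) * b (x n)) atTop (𝓝 0) := by
    refine squeeze_zero_norm (a := fun n ↦ |a' (x n)| * √(a (x n) ^ 2 + b (x n) ^ 2)) (fun n ↦ ?_) ?_
    · rw [norm_mul]
      gcongr
      · exact le_rfl
      · exact Real.abs_le_sqrt (by nlinarith)
    · simpa using h2.abs.mul h1.sqrt
  have hb : Tendsto (fun n ↦ b' (x n) * a (x n)) atTop (𝓝 0) := by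
    refine squeeze_zero_norm (a := fun n ↦ |b' (x n)| * √(a (x n) ^ 2 + b (x n) ^ 2)) (fun n ↦ ?_) ?_
    · rw [norm_mul]
      gcongr
      · exact le_rfl
      · exact Real.abs_le_sqrt (by nlinarith)
    · simpa using h3.abs.mul h1.sqrt
  constructor
  · have hlim : Tendsto (fun n ↦ a' (x n) ^ 2 + b' (x n) ^ 2 -
        potential r₀ F (a (x n) ^ 2 + b (x n) ^ 2)) atTop (𝓝 0) := by
      have := ((h2.pow 2).add (h3.pow 2)).sub
        (((continuous_potential (r₀ := r₀) hF).tendsto (r₀ ^ 2)).comp h1)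
      simpa [potential] using this
    have := tendsto_nhds_unique (hlim.congr fun n ↦ h.energy_eq hF (x n) s) tendsto_const_nhds
    linarith
  · have hlim : Tendsto (fun n ↦ a' (x n) * b (x n) - b' (x n) * a (x n) +
        c / 2 * (a (x n) ^ 2 + b (x n) ^ 2)) atTop (𝓝 (c / 2 * r₀ ^ 2)) := by
      simpa using (ha.sub hb).add (h1.const_mul (c / 2))
    have := tendsto_nhds_unique (hlim.congr fun n ↦ h.momentum_eq (x n) s) tendsto_const_nhds
    linarith

/-- A finite energy profile is either a constant of modulus `r₀` or it leaves a neighbourhood of the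
circle of radius `r₀` whose size depends on the nonlinearity only. -/
lemma IsProfile.trivial_or_exists_le
    (h : IsProfile F c a b a' b') (hF : Continuous F) (hφ : IsTruncation r₀ φ) (hr₀ : 0 < r₀)
    (hE : Integrable fun s ↦ a' s ^ 2 + b' s ^ 2 + (φ √(a s ^ 2 + b s ^ 2) ^ 2 - r₀ ^ 2) ^ 2) {l : ℝ} (hl : ∀ s, s ≠ r₀ ^ 2 → |s - r₀ ^ 2| < l →
      c ^ 2 * (s - r₀ ^ 2) ^ 2 < 4 * s * potential r₀ F s) :
    (∀ s, a' s = 0 ∧ b' s = 0 ∧ a s ^ 2 + b s ^ 2 = r₀ ^ 2) ∨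
      ∃ s, l ≤ |a s ^ 2 + b s ^ 2 - r₀ ^ 2| := by
  by_contra! H
  obtain ⟨⟨s₀, hs₀⟩, hsmall⟩ := H
  set g : ℝ → ℝ := fun s ↦ a s ^ 2 + b s ^ 2 - r₀ ^ 2 with hg
  have hgd : ∀ s, HasDerivAt g (2 * (a s * a' s + b s * b' s)) s := fun s ↦
    (h.hasDerivAt_sq s).sub_const _
  -- By Lagrange's identity and the first integrals, a zero of the derivative would give `c² g² = 4
  -- |u|² V(|u|²)`, contrary to `hl`.
  have hgd0 : ∀ s, g s ≠ 0 → a s * a' s + b s * b' s ≠ 0 := by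
    intro s hgs hzero
    obtain ⟨h1, h2⟩ := h.first_integrals hF hφ hr₀ hE s
    have h3 := hl _ (sub_ne_zero.1 hgs) (hsmall s)
    rw [← h1] at h3
    have h4 : (a s * a' s + b s * b' s) ^ 2 + (a' s * b s - b' s * a s) ^ 2 =
      (a s ^ 2 + b s ^ 2) * (a' s ^ 2 + b' s ^ 2) := by ring
    rw [hzero, h2] at h4
    nlinarith
  -- Where the modulus is `r₀` the energy identity forces `u' = 0`, so triviality can only fail at a
  -- point with modulus different from `r₀`.
  have hg0 : g s₀ ≠ 0 := by
    intro hgs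
    obtain ⟨h1, -⟩ := h.first_integrals hF hφ hr₀ hE s₀
    have h2 : a s₀ ^ 2 + b s₀ ^ 2 = r₀ ^ 2 := sub_eq_zero.1 hgs
    rw [h2, potential, intervalIntegral.integral_same] at h1
    have ha : a' s₀ ^ 2 = 0 := by nlinarith [sq_nonneg (a' s₀), sq_nonneg (b' s₀)]
    have hb : b' s₀ ^ 2 = 0 := by nlinarith [sq_nonneg (a' s₀), sq_nonneg (b' s₀)]
    exact hs₀ (pow_eq_zero_iff two_ne_zero |>.1 ha) (pow_eq_zero_iff two_ne_zero |>.1 hb) h2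
  have hpos : 0 < g s₀ ^ 2 := by positivity
  have small : ∀ x : ℕ → ℝ, Tendsto ((fun s ↦ a' s ^ 2 + b' s ^ 2 +
      (φ √(a s ^ 2 + b s ^ 2) ^ 2 - r₀ ^ 2) ^ 2) ∘ x) atTop (𝓝 0) →
      ∀ᶠ n in atTop, g (x n) ^ 2 < g s₀ ^ 2 := by
    intro x hx
    have h1 := (((tendsto_sq_add_sq hφ hr₀ hx).1.sub_const (r₀ ^ 2)).pow 2)
    rw [sub_self, zero_pow two_ne_zero] at h1
    exact h1.eventually (gt_mem_nhds hpos)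
  obtain ⟨x, hx1, hx2⟩ := exists_seq_tendsto_zero_atTop hE fun s ↦ by positivity
  obtain ⟨y, hy1, hy2⟩ := exists_seq_tendsto_zero_atBot hE fun s ↦ by positivity
  obtain ⟨n, hn1, hn2⟩ := ((small x hx2).and (hx1.eventually_gt_atTop s₀)).exists
  obtain ⟨m, hm1, hm2⟩ := ((small y hy2).and (hy1.eventually_lt_atBot s₀)).exists
  have hgc : Continuous g := continuous_iff_continuousAt.2 fun s ↦ (hgd s).continuousAt
  -- At both ends of the window `g²` is below its value at `s₀`, so the maximum is interior and is a
  -- critical point with `g ≠ 0`.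
  obtain ⟨t, ht, hmax⟩ := isCompact_Icc.exists_isMaxOn (s := Set.Icc (y m) (x n))
    ⟨s₀, hm2.le, hn2.le⟩ (hgc.pow 2).continuousOn
  have hts : g s₀ ^ 2 ≤ g t ^ 2 := hmax ⟨hm2.le, hn2.le⟩
  have ht1 : y m < t := lt_of_le_of_ne ht.1 (by rintro rfl; exact absurd hm1 (not_lt.2 hts))
  have ht2 : t < x n := lt_of_le_of_ne ht.2 (by rintro rfl; exact absurd hn1 (not_lt.2 hts))
  have hloc : IsLocalMax (fun s ↦ g s ^ 2) t := hmax.isLocalMax (Icc_mem_nhds ht1 ht2)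
  have hd := hloc.hasDerivAt_eq_zero ((hgd t).pow 2)
  have hgt : g t ≠ 0 := fun h0 ↦ by rw [h0] at hts; linarith
  have := hgd0 t hgt
  simp [hgt, this] at hd

/-- One-dimensional interpolation: a function which is square integrable along with its derivative is
bounded by the square root of the product of the two norms. -/
lemma norm_sq_le_integral_add_integral {E : Type*} [NormedAddCommGroup E] [InnerProductSpace ℝ E]
    {f f' : ℝ → E} (hf : ∀ s, HasDerivAt f (f' s) s) (hf' : Continuous f')
    (hfi : Integrable fun s ↦ ‖f s‖ ^ 2) (hfi' : Integrable fun s ↦ ‖f' s‖ ^ 2) {ε : ℝ} (hε : 0 < ε)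
    (s : ℝ) : ‖f s‖ ^ 2 ≤ ε⁻¹ * (∫ t, ‖f t‖ ^ 2) + ε * ∫ t, ‖f' t‖ ^ 2 := by
  have hfc : Continuous f := continuous_iff_continuousAt.2 fun s ↦ (hf s).continuousAt
  obtain ⟨x, hx1, hx2⟩ := exists_seq_tendsto_zero_atTop hfi fun s ↦ by positivity
  have hsum : Integrable fun t ↦ ε⁻¹ * ‖f t‖ ^ 2 + ε * ‖f' t‖ ^ 2 :=
    (hfi.const_mul _).add (hfi'.const_mul _)
  -- Young's inequality for minus the derivative of `‖f‖²`, integrated from `s` to points where `f`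
  -- tends to `0`. The weight `ε` stays free, to be tuned to the translation step later.
  have hbound : ∀ t, -(2 * inner ℝ (f t) (f' t)) ≤ ε⁻¹ * ‖f t‖ ^ 2 + ε * ‖f' t‖ ^ 2 := by
    intro t
    have h1 := neg_le_of_abs_le (abs_real_inner_le_norm (f t) (f' t))
    have h2 : 2 * (‖f t‖ * ‖f' t‖) ≤ ε⁻¹ * ‖f t‖ ^ 2 + ε * ‖f' t‖ ^ 2 := by
      have h3 : ε⁻¹ * ‖f t‖ ^ 2 + ε * ‖f' t‖ ^ 2 - 2 * (‖f t‖ * ‖f' t‖) =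
          ε⁻¹ * (‖f t‖ - ε * ‖f' t‖) ^ 2 := by field_simp; ring
      have h4 : 0 ≤ ε⁻¹ * (‖f t‖ - ε * ‖f' t‖) ^ 2 := by positivity
      linarith
    linarith
  have key : ∀ᶠ n in atTop, ‖f s‖ ^ 2 ≤
      ε⁻¹ * (∫ t, ‖f t‖ ^ 2) + ε * (∫ t, ‖f' t‖ ^ 2) + ‖f (x n)‖ ^ 2 := by
    filter_upwards [hx1.eventually_ge_atTop s] with n hn
    have hc : Continuous fun t ↦ 2 * inner ℝ (f t) (f' t) := by fun_prop
    have h1 := intervalIntegral.integral_eq_sub_of_hasDerivAt (a := s) (b := x n)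
      (fun t _ ↦ (hf t).norm_sq) (hc.intervalIntegrable _ _)
    have h2 := intervalIntegral.integral_mono_on (μ := volume) hn (hc.neg.intervalIntegrable _ _)
      hsum.intervalIntegrable (fun t _ ↦ hbound t)
    simp only [Pi.neg_apply] at h2
    rw [intervalIntegral.integral_neg, h1, intervalIntegral.integral_of_le hn] at h2
    have h3 := setIntegral_le_integral (s := Set.Ioc s (x n)) hsum
      (ae_of_all _ fun t ↦ by positivity)
    rw [integral_add (hfi.const_mul _) (hfi'.const_mul _), integral_const_mul,
      integral_const_mul] at h3
    linarith
  have hlim : Tendsto (fun n ↦ ε⁻¹ * (∫ t, ‖f t‖ ^ 2) + ε * (∫ t, ‖f' t‖ ^ 2) + ‖f (x n)‖ ^ 2) atTop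
      (𝓝 (ε⁻¹ * (∫ t, ‖f t‖ ^ 2) + ε * (∫ t, ‖f' t‖ ^ 2) + 0)) := hx2.const_add _
  simpa using ge_of_tendsto hlim key

/-- If one of the integrals is infinite the right side is `⊤`, so the inequality applies to
differences of slices without any integrability check. -/
lemma enorm_sq_le_lintegral_add_lintegral {E : Type*} [NormedAddCommGroup E]
    [InnerProductSpace ℝ E] {f f' : ℝ → E} (hf : ∀ s, HasDerivAt f (f' s) s) (hf' : Continuous f')
    {ε : ℝ} (hε : 0 < ε) (s : ℝ) :
    ‖f s‖ₑ ^ 2 ≤ ENNReal.ofReal ε⁻¹ * (∫⁻ t, ‖f t‖ₑ ^ 2) +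
      ENNReal.ofReal ε * ∫⁻ t, ‖f' t‖ₑ ^ 2 := by
  have hfc : Continuous f := continuous_iff_continuousAt.2 fun s ↦ (hf s).continuousAt
  have hconv : ∀ g : ℝ → E, ∀ t, ‖g t‖ₑ ^ 2 = ENNReal.ofReal (‖g t‖ ^ 2) := fun g t ↦ by
    rw [ENNReal.ofReal_pow (norm_nonneg _), ofReal_norm]
  by_cases h1 : ∫⁻ t, ‖f t‖ₑ ^ 2 = ⊤
  · rw [h1, ENNReal.mul_top (by simpa using hε)]; simp
  by_cases h2 : ∫⁻ t, ‖f' t‖ₑ ^ 2 = ⊤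
  · rw [h2, ENNReal.mul_top (by simpa using hε)]; simp
  have hint : ∀ g : ℝ → E, Continuous g → ∫⁻ t, ‖g t‖ₑ ^ 2 ≠ ⊤ →
      Integrable fun t ↦ ‖g t‖ ^ 2 := by
    intro g hg h
    refine ⟨(hg.norm.pow 2).aestronglyMeasurable, ?_⟩
    rw [hasFiniteIntegral_iff_ofReal (ae_of_all _ fun t ↦ by positivity)]
    simpa only [hconv] using Ne.lt_top h
  have hi := hint f hfc h1
  have hi' := hint f' hf' h2
  have := norm_sq_le_integral_add_integral hf hf' hi hi' hε s
  simp only [hconv]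
  rw [← ofReal_integral_eq_lintegral_ofReal hi (ae_of_all _ fun t ↦ by positivity),
    ← ofReal_integral_eq_lintegral_ofReal hi' (ae_of_all _ fun t ↦ by positivity),
    ← ENNReal.ofReal_mul (by positivity), ← ENNReal.ofReal_mul hε.le, ← ENNReal.ofReal_add]
  · exact ENNReal.ofReal_le_ofReal this
  · exact mul_nonneg (by positivity) (integral_nonneg fun t ↦ by positivity)
  · exact mul_nonneg hε.le (integral_nonneg fun t ↦ by positivity)

/-- A profile leaving a neighbourhood of the circle of radius `r₀` carries a minimal energy. -/
lemma IsProfile.arctan_sq_le (h : IsProfile F c a b a' b') (hφ : IsTruncation r₀ φ) (hr₀ : 0 < r₀)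
    (hE : Integrable fun s ↦ a' s ^ 2 + b' s ^ 2 + (φ √(a s ^ 2 + b s ^ 2) ^ 2 - r₀ ^ 2) ^ 2)
    {l : ℝ} (hl0 : 0 ≤ l) {s : ℝ} (hs : l ≤ |a s ^ 2 + b s ^ 2 - r₀ ^ 2|) :
    Real.arctan l ^ 2 ≤ ((1 + 1 / r₀ ^ 2) ^ 2 + 4 * (1 + r₀ ^ 2)) *
      ∫ s, (a' s ^ 2 + b' s ^ 2 + (φ √(a s ^ 2 + b s ^ 2) ^ 2 - r₀ ^ 2) ^ 2) := by
  set g : ℝ → ℝ := fun s ↦ a s ^ 2 + b s ^ 2 - r₀ ^ 2 with hg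
  have hgd : ∀ s, HasDerivAt g (2 * (a s * a' s + b s * b' s)) s := fun s ↦
    (h.hasDerivAt_sq s).sub_const _
  have hac : Continuous a := continuous_iff_continuousAt.2 fun s ↦ (h.hasDerivAt_re s).continuousAt
  have hbc : Continuous b := continuous_iff_continuousAt.2 fun s ↦ (h.hasDerivAt_im s).continuousAt
  have hac' : Continuous a' :=
    continuous_iff_continuousAt.2 fun s ↦ (h.hasDerivAt_re' s).continuousAt
  have hbc' : Continuous b' :=
    continuous_iff_continuousAt.2 fun s ↦ (h.hasDerivAt_im' s).continuousAt
  have hgc : Continuous g := by fun_prop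
  -- Interpolation is applied to `arctan g`, since `|u|` has no a priori bound. In the derivative,
  -- the denominator `1 + g²` absorbs the factor `|u|` coming from Cauchy-Schwarz.
  have hfd : ∀ s, HasDerivAt (fun s ↦ Real.arctan (g s))
      (1 / (1 + g s ^ 2) * (2 * (a s * a' s + b s * b' s))) s := fun s ↦ (hgd s).arctan
  have hfc' : Continuous fun s ↦ 1 / (1 + g s ^ 2) * (2 * (a s * a' s + b s * b' s)) := by
    refine (continuous_const.div (by fun_prop) fun s ↦ by positivity).mul (by fun_prop)
  have hb1 : ∀ s, ‖Real.arctan (g s)‖ ^ 2 ≤ (1 + 1 / r₀ ^ 2) ^ 2 *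
      (a' s ^ 2 + b' s ^ 2 + (φ √(a s ^ 2 + b s ^ 2) ^ 2 - r₀ ^ 2) ^ 2) := by
    intro s
    have h1 := hφ.abs_arctan_le hr₀ (Real.sqrt_nonneg (a s ^ 2 + b s ^ 2))
    rw [Real.sq_sqrt (by positivity)] at h1
    calc ‖Real.arctan (g s)‖ ^ 2 ≤
          ((1 + 1 / r₀ ^ 2) * |φ √(a s ^ 2 + b s ^ 2) ^ 2 - r₀ ^ 2|) ^ 2 := by
          rw [Real.norm_eq_abs]; gcongr
      _ = (1 + 1 / r₀ ^ 2) ^ 2 * (φ √(a s ^ 2 + b s ^ 2) ^ 2 - r₀ ^ 2) ^ 2 := by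
          rw [mul_pow, sq_abs]
      _ ≤ _ := by
          gcongr
          have := sq_nonneg (a' s)
          have := sq_nonneg (b' s)
          linarith
  have hb2 : ∀ s, ‖1 / (1 + g s ^ 2) * (2 * (a s * a' s + b s * b' s))‖ ^ 2 ≤ 4 * (1 + r₀ ^ 2) *
      (a' s ^ 2 + b' s ^ 2 + (φ √(a s ^ 2 + b s ^ 2) ^ 2 - r₀ ^ 2) ^ 2) := by
    intro s
    have h1 : (a s * a' s + b s * b' s) ^ 2 ≤ (a s ^ 2 + b s ^ 2) * (a' s ^ 2 + b' s ^ 2) := by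
      nlinarith [sq_nonneg (a s * b' s - b s * a' s)]
    have h2 : a s ^ 2 + b s ^ 2 ≤ (1 + r₀ ^ 2) * (1 + g s ^ 2) ^ 2 := by
      have h3 : a s ^ 2 + b s ^ 2 = g s + r₀ ^ 2 := by simp [hg]
      rw [h3]
      nlinarith [sq_nonneg (g s - 1), sq_nonneg (g s), sq_nonneg (g s ^ 2), sq_nonneg r₀,
        mul_nonneg (sq_nonneg r₀) (sq_nonneg (g s)), mul_nonneg (sq_nonneg r₀) (sq_nonneg (g s ^ 2))]
    rw [Real.norm_eq_abs, sq_abs, mul_pow, div_pow, one_pow, one_div, inv_mul_le_iff₀ (by positivity)]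
    have h4 : (2 * (a s * a' s + b s * b' s)) ^ 2 ≤
        4 * ((1 + r₀ ^ 2) * (1 + g s ^ 2) ^ 2 * (a' s ^ 2 + b' s ^ 2)) := by
      rw [mul_pow]
      have := h1.trans (mul_le_mul_of_nonneg_right h2 (by positivity))
      linarith
    refine h4.trans ?_
    have h5 : 0 ≤ (1 + g s ^ 2) ^ 2 * (4 * (1 + r₀ ^ 2)) *
      (φ √(a s ^ 2 + b s ^ 2) ^ 2 - r₀ ^ 2) ^ 2 := by positivity
    linarith
  have hi1 : Integrable fun s ↦ ‖Real.arctan (g s)‖ ^ 2 :=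
    (hE.const_mul _).mono' (by fun_prop) (ae_of_all _ fun s ↦ by
      rw [Real.norm_of_nonneg (by positivity)]; exact hb1 s)
  have hi2 : Integrable fun s ↦ ‖1 / (1 + g s ^ 2) * (2 * (a s * a' s + b s * b' s))‖ ^ 2 :=
    (hE.const_mul _).mono' (hfc'.norm.pow 2).aestronglyMeasurable (ae_of_all _ fun s ↦ by
      rw [Real.norm_of_nonneg (by positivity)]; exact hb2 s)
  have h1 := norm_sq_le_integral_add_integral hfd hfc' hi1 hi2 one_pos s
  have h2 := integral_mono hi1 (hE.const_mul _) hb1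
  have h3 := integral_mono hi2 (hE.const_mul _) hb2
  rw [integral_const_mul] at h2 h3
  have h4 : Real.arctan l ^ 2 ≤ ‖Real.arctan (g s)‖ ^ 2 := by
    rw [Real.norm_eq_abs]
    have h5 : Real.arctan l ≤ |Real.arctan (g s)| := by
      rcases abs_cases (g s) with ⟨h6, -⟩ | ⟨h6, -⟩
      · exact (Real.arctan_mono (hs.trans h6.le)).trans (le_abs_self _)
      · refine (Real.arctan_mono (hs.trans h6.le)).trans ?_
        rw [Real.arctan_neg]
        exact neg_le_abs _
    exact pow_le_pow_left₀ (Real.arctan_nonneg.2 hl0) h5 2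
  rw [inv_one, one_mul, one_mul] at h1
  rw [add_mul]
  linarith

end Profile

/-! ### Weak derivatives on the line -/

section Line

variable {E : Type*} [NormedAddCommGroup E] [NormedSpace ℝ E] [CompleteSpace E]

lemma integral_deriv_eq_zero {α : ℝ → ℝ} (hα : ContDiff ℝ 1 α) (hαc : HasCompactSupport α) :
    ∫ s, deriv α s = 0 :=
  integral_eq_zero_of_hasDerivAt_of_integrable
    (fun s ↦ (hα.differentiable one_ne_zero s).hasDerivAt)
    ((hα.continuous_deriv le_rfl).integrable_of_hasCompactSupport hαc.deriv)
    (hα.continuous.integrable_of_hasCompactSupport hαc)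

/-- Integration by parts against the primitive of a locally integrable function. -/
lemma integral_deriv_smul_primitive {α : ℝ → ℝ} (hα : ContDiff ℝ 1 α) (hαc : HasCompactSupport α)
    {g : ℝ → E} (hg : LocallyIntegrable g) :
    ∫ s, deriv α s • (∫ t in (0 : ℝ)..s, g t) = -∫ s, α s • g s := by
  have hgi : ∀ a b, IntervalIntegrable g volume a b := fun a b ↦
    (hg.integrableOn_isCompact isCompact_uIcc).intervalIntegrable
  obtain ⟨M, hM⟩ := hαc.isCompact.isBounded.subset_closedBall 0
  have hαM : ∀ s, M < |s| → α s = 0 := fun s hs ↦ image_eq_zero_of_notMem_tsupport fun h ↦ by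
    have := hM h
    rw [mem_closedBall_zero_iff, Real.norm_eq_abs] at this
    linarith
  have hα'M : ∀ s, M < |s| → deriv α s = 0 := fun s hs ↦
    image_eq_zero_of_notMem_tsupport fun h ↦ by
      have := hM ((closure_minimal (support_deriv_subset) (isClosed_tsupport _)) h)
      rw [mem_closedBall_zero_iff, Real.norm_eq_abs] at this
      linarith
  have hα'i : Integrable (deriv α) :=
    (hα.continuous_deriv le_rfl).integrable_of_hasCompactSupport hαc.deriv
  set G : ℝ → E := (Set.Ioc (-M) M).indicator g with hG
  have hGi : Integrable G := by
    rw [integrable_indicator_iff measurableSet_Ioc]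
    exact (hg.integrableOn_isCompact isCompact_Icc).mono_set Set.Ioc_subset_Icc_self
  set T : Set (ℝ × ℝ) := {z | z.2 ≤ z.1} with hT
  have hTm : MeasurableSet T := measurableSet_le measurable_snd measurable_fst
  -- Fubini on the triangle `τ ≤ s`: integrating in `τ` first gives `α'` times the primitive from
  -- `-M`, in `s` first gives `-α g`. The base point is immaterial because `α'` has integral zero.
  set h : ℝ × ℝ → E := T.indicator fun z ↦ deriv α z.1 • G z.2 with hh
  have hhi : Integrable h (volume.prod volume) := (hα'i.smul_prod hGi).indicator hTm
  have h1 : ∀ s, ∫ τ, h (s, τ) = deriv α s • ∫ t in (-M)..s, g t := by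
    intro s
    by_cases hs : M < |s|
    · simp [hh, Set.indicator, hα'M s hs]
    · have hs' := abs_le.1 (not_lt.1 hs)
      have : ∀ τ, h (s, τ) = deriv α s • (Set.Ioc (-M) s).indicator g τ := by
        intro τ
        by_cases h1 : τ ≤ s
        · by_cases h2 : -M < τ
          · simp [hh, hT, hG, h1, h2, h1.trans hs'.2]
          · simp [hh, hT, hG, h1, h2]
        · simp [hh, hT, hG, h1]
      simp_rw [this]
      rw [integral_smul, integral_indicator measurableSet_Ioc,
        intervalIntegral.integral_of_le hs'.1]
  have h2 : ∀ τ, ∫ s, h (s, τ) = -(α τ • g τ) := by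
    intro τ
    have : ∀ s, h (s, τ) = (Set.Ici τ).indicator (deriv α) s • G τ := by
      intro s
      by_cases h1 : τ ≤ s <;> simp [hh, hT, h1]
    simp_rw [this]
    rw [integral_smul_const, integral_indicator measurableSet_Ici, integral_Ici_eq_integral_Ioi,
      hαc.integral_Ioi_deriv_eq hα, neg_smul, hG, neg_inj]
    by_cases h3 : τ ∈ Set.Ioc (-M) M
    · rw [Set.indicator_of_mem h3]
    · rw [Set.indicator_of_notMem h3, smul_zero]
      by_cases h4 : M < |τ|
      · simp [hαM τ h4]
      -- The half-open interval misses the endpoint `-M`, where `α` vanishes by continuity.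
      · have h5 : τ = -M := by
          have := abs_le.1 (not_lt.1 h4)
          simp only [Set.mem_Ioc, not_and_or, not_lt, not_le] at h3
          rcases h3 with h3 | h3 <;> linarith
        have h6 : α (-M) = 0 := by
          have hcl : IsClosed {s : ℝ | α s = 0} := isClosed_eq hα.continuous continuous_const
          have hM0 : 0 ≤ M := (abs_nonneg τ).trans (not_lt.1 h4)
          have : Set.Iio (-M) ⊆ {s : ℝ | α s = 0} := fun s hs ↦ hαM s (by
            rw [abs_of_neg (by linarith [Set.mem_Iio.1 hs])]; linarith [Set.mem_Iio.1 hs])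
          have := closure_minimal this hcl
          rw [closure_Iio] at this
          exact this (Set.mem_Iic.2 le_rfl)
        simp [h5, h6]
  have h3 : ∀ s, deriv α s • (∫ t in (0 : ℝ)..s, g t) =
      (∫ τ, h (s, τ)) - deriv α s • ∫ t in (-M)..0, g t := by
    intro s
    rw [h1, ← smul_sub, ← intervalIntegral.integral_add_adjacent_intervals (hgi (-M) 0) (hgi 0 s),
      add_sub_cancel_left]
  simp_rw [h3]
  rw [integral_sub hhi.integral_prod_left (hα'i.smul_const _), integral_smul_const,
    integral_deriv_eq_zero hα hαc, zero_smul, sub_zero, ← integral_neg, ← integral_congr_ae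
      (ae_of_all _ h2)]
  exact integral_integral_swap hhi

/-- A sequence of smooth bumps on the line, concentrating at the origin. -/
noncomputable def lineBump (n : ℕ) : ContDiffBump (0 : ℝ) where
  rIn := 1 / ((n : ℝ) + 1) / 2
  rOut := 1 / ((n : ℝ) + 1)
  rIn_pos := by positivity
  rIn_lt_rOut := half_lt_self (by positivity)

/-- A test function whose derivative is the difference of two translated bumps. -/
noncomputable def bumpPrimitive (n : ℕ) (p q s : ℝ) : ℝ :=
  ∫ t in (s - q)..(s - p), (lineBump n).normed volume t

lemma hasDerivAt_bumpPrimitive (n : ℕ) (p q s : ℝ) : HasDerivAt (bumpPrimitive n p q)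
    ((lineBump n).normed volume (s - p) - (lineBump n).normed volume (s - q)) s := by
  have hc : Continuous ((lineBump n).normed volume : ℝ → ℝ) := (lineBump n).continuous_normed
  have h1 : ∀ r : ℝ, HasDerivAt (fun s ↦ ∫ t in (0 : ℝ)..(s - r), (lineBump n).normed volume t)
      ((lineBump n).normed volume (s - r)) s := fun r ↦ by
    exact (hc.integral_hasStrictDerivAt 0 (s - r)).hasDerivAt.comp_sub_const s r
  refine ((h1 p).sub (h1 q)).congr_of_eventuallyEq (Eventually.of_forall fun x ↦ ?_)
  simp only [bumpPrimitive, Pi.sub_apply]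
  rw [intervalIntegral.integral_interval_sub_left (hc.intervalIntegrable _ _)
    (hc.intervalIntegrable _ _)]

lemma deriv_bumpPrimitive (n : ℕ) (p q : ℝ) : deriv (bumpPrimitive n p q) =
    fun s ↦ (lineBump n).normed volume (s - p) - (lineBump n).normed volume (s - q) :=
  funext fun s ↦ (hasDerivAt_bumpPrimitive n p q s).deriv

lemma contDiff_bumpPrimitive (n : ℕ) (p q : ℝ) : ContDiff ℝ ∞ (bumpPrimitive n p q) := by
  rw [contDiff_infty_iff_deriv]
  refine ⟨fun s ↦ (hasDerivAt_bumpPrimitive n p q s).differentiableAt, ?_⟩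
  rw [deriv_bumpPrimitive]
  have hc : ContDiff ℝ ∞ ((lineBump n).normed volume : ℝ → ℝ) := (lineBump n).contDiff_normed
  exact (hc.comp (contDiff_id.sub contDiff_const)).sub (hc.comp (contDiff_id.sub contDiff_const))

lemma hasCompactSupport_bumpPrimitive (n : ℕ) (p q : ℝ) :
    HasCompactSupport (bumpPrimitive n p q) := by
  have hz : ∀ t : ℝ, 1 ≤ |t| → (lineBump n).normed volume t = 0 := by
    intro t ht
    rw [← Function.notMem_support, (lineBump n).support_normed_eq, mem_ball_zero_iff, not_lt]
    refine le_trans ?_ ht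
    simp only [lineBump]
    exact (div_le_one (by positivity)).2 (by linarith [(Nat.cast_nonneg n : (0 : ℝ) ≤ n)])
  refine HasCompactSupport.intro (isCompact_closedBall (0 : ℝ) (|p| + |q| + 1)) fun s hs ↦ ?_
  rw [mem_closedBall_zero_iff, not_le, Real.norm_eq_abs] at hs
  rw [bumpPrimitive, intervalIntegral.integral_congr (g := fun _ ↦ (0 : ℝ))]
  · simp
  · intro t ht
    refine hz t ?_
    have hp := abs_le.1 (le_refl |p|)
    have hq := abs_le.1 (le_refl |q|)
    have := abs_nonneg p
    have := abs_nonneg q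
    rw [Set.mem_uIcc] at ht
    rcases lt_abs.1 hs with h | h
    · exact le_abs.2 (Or.inl (by rcases ht with ht | ht <;> linarith))
    · exact le_abs.2 (Or.inr (by rcases ht with ht | ht <;> linarith))

/-- A locally integrable function with vanishing weak derivative, tested on countably many
functions, is constant. -/
lemma exists_ae_eq_const_of_integral_deriv_smul_eq_zero {f : ℝ → E} (hf : LocallyIntegrable f)
    (h : ∀ (n : ℕ) (p q : ℚ), ∫ s, deriv (bumpPrimitive n p q) s • f s = 0) :
    ∃ k, ∀ᵐ s, f s = k := by
  set L := ContinuousLinearMap.lsmul ℝ ℝ (E := E)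
  set C : ℕ → ℝ → E := fun n ↦ convolution ((lineBump n).normed volume) f L volume with hC
  have hbc : ∀ n, Continuous ((lineBump n).normed volume : ℝ → ℝ) := fun n ↦
    (lineBump n).continuous_normed
  have hcont : ∀ n, Continuous (C n) := fun n ↦
    (lineBump n).hasCompactSupport_normed.continuous_convolution_left _ (hbc n) hf
  have hCeq : ∀ n p, C n p = ∫ s, (lineBump n).normed volume (s - p) • f s := by
    intro n p
    simp only [hC, convolution_eq_swap]
    refine integral_congr_ae (ae_of_all _ fun s ↦ ?_)
    simp only [L, ContinuousLinearMap.lsmul_apply]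
    rw [← (lineBump n).normed_neg, neg_sub]
  have hint : ∀ n (p : ℝ), Integrable fun s ↦ (lineBump n).normed volume (s - p) • f s := by
    intro n p
    refine hf.integrable_smul_left_of_hasCompactSupport ((hbc n).comp (continuous_sub_right p)) ?_
    exact ((lineBump n).hasCompactSupport_normed (μ := volume)).comp_homeomorph
      (Homeomorph.subRight p)
  -- The hypothesis says that the mollification `C n` takes equal values at any two rationals; by
  -- continuity it is constant. The mollifications converge to `f` almost everywhere.
  have hconst : ∀ n (p q : ℝ), C n p = C n q := by
    intro n
    have hrat : ∀ p q : ℚ, C n p = C n q := by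
      intro p q
      have := h n p q
      simp only [deriv_bumpPrimitive, sub_smul] at this
      rw [integral_sub (hint n p) (hint n q), ← hCeq, ← hCeq] at this
      exact sub_eq_zero.1 this
    have : C n = fun _ ↦ C n ((0 : ℚ) : ℝ) :=
      (hcont n).ext_on Rat.denseRange_cast continuous_const (by rintro _ ⟨p, rfl⟩; exact hrat p 0)
    intro p q
    rw [this]
  have hconv : ∀ᵐ s, Tendsto (fun n ↦ C n s) atTop (𝓝 (f s)) := by
    refine ContDiffBump.ae_convolution_tendsto_right_of_locallyIntegrable (φ := lineBump) (K := 2)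
      tendsto_one_div_add_atTop_nhds_zero_nat (Eventually.of_forall fun n ↦ ?_) hf
    simp only [lineBump]
    linarith
  obtain ⟨s₀, hs₀⟩ := hconv.exists
  refine ⟨f s₀, ?_⟩
  filter_upwards [hconv] with s hs
  exact tendsto_nhds_unique hs (hs₀.congr fun n ↦ hconst n _ _)

lemma exists_ae_eq_const_add_primitive {f g : ℝ → E} (hf : LocallyIntegrable f)
    (hg : LocallyIntegrable g) (h : ∀ (n : ℕ) (p q : ℚ),
      ∫ s, deriv (bumpPrimitive n p q) s • f s = -∫ s, bumpPrimitive n p q s • g s) :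
    ∃ k, ∀ᵐ s, f s = k + ∫ t in (0 : ℝ)..s, g t := by
  have hgc : Continuous fun s ↦ ∫ t in (0 : ℝ)..s, g t :=
    intervalIntegral.continuous_primitive (fun a b ↦
      (hg.integrableOn_isCompact isCompact_uIcc).intervalIntegrable) 0
  obtain ⟨k, hk⟩ := exists_ae_eq_const_of_integral_deriv_smul_eq_zero
    (f := fun s ↦ f s - ∫ t in (0 : ℝ)..s, g t) (hf.sub hgc.locallyIntegrable) fun n p q ↦ by
      have hd : Continuous (deriv (bumpPrimitive n p q)) :=
        (contDiff_bumpPrimitive n p q).continuous_deriv (by simp)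
      have hdc := (hasCompactSupport_bumpPrimitive n p q).deriv
      simp only [smul_sub]
      rw [integral_sub (hf.integrable_smul_left_of_hasCompactSupport hd hdc)
        (hgc.locallyIntegrable.integrable_smul_left_of_hasCompactSupport hd hdc), h,
        integral_deriv_smul_primitive ((contDiff_bumpPrimitive n p q).of_le (by simp))
          (hasCompactSupport_bumpPrimitive n p q) hg, sub_self]
  exact ⟨k, hk.mono fun s hs ↦ by rw [← hs]; abel⟩

end Line

/-! ### Slicing `ℝ^{n+1}` along a coordinate direction -/

section Slices

variable {n : ℕ} {E : Type*} [NormedAddCommGroup E]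

/-- The point of `ℝ^{n+1}` with `i`-th coordinate `s` and remaining coordinates `y`. -/
noncomputable def slicePoint (i : Fin (n + 1)) (z : ℝ × (Fin n → ℝ)) : Space (n + 1) :=
  WithLp.toLp 2 (i.insertNth z.1 z.2 : Fin (n + 1) → ℝ)

@[simp] lemma slicePoint_apply_same (i : Fin (n + 1)) (z : ℝ × (Fin n → ℝ)) :
    slicePoint i z i = z.1 := by simp [slicePoint]

@[simp] lemma slicePoint_apply_succAbove (i : Fin (n + 1)) (z : ℝ × (Fin n → ℝ)) (j : Fin n) :
    slicePoint i z (i.succAbove j) = z.2 j := by simp [slicePoint]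

lemma slicePoint_add (i : Fin (n + 1)) (z w : ℝ × (Fin n → ℝ)) :
    slicePoint i (z + w) = slicePoint i z + slicePoint i w := by
  ext j
  refine Fin.succAboveCases i ?_ (fun k ↦ ?_) j <;> simp

lemma slicePoint_single_left (i : Fin (n + 1)) (h : ℝ) :
    slicePoint i (h, 0) = h • EuclideanSpace.single i 1 := by
  ext j
  refine Fin.succAboveCases i ?_ (fun k ↦ ?_) j <;> simp

lemma continuous_slicePoint (i : Fin (n + 1)) : Continuous (slicePoint i) :=
  (PiLp.continuous_toLp 2 _).comp (Continuous.finInsertNth i continuous_fst continuous_snd)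

lemma measurePreserving_slicePoint (i : Fin (n + 1)) :
    MeasurePreserving (slicePoint (n := n) i) (volume.prod volume) volume :=
  (PiLp.volume_preserving_toLp (Fin (n + 1))).comp
    (volume_preserving_piFinSuccAbove (fun _ : Fin (n + 1) ↦ ℝ) i).symm

lemma measurableEmbedding_slicePoint (i : Fin (n + 1)) :
    MeasurableEmbedding (slicePoint (n := n) i) :=
  (MeasurableEquiv.toLp 2 (Fin (n + 1) → ℝ)).measurableEmbedding.comp
    (MeasurableEquiv.piFinSuccAbove (fun _ : Fin (n + 1) ↦ ℝ) i).symm.measurableEmbedding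

lemma integrableOn_comp_slicePoint {f : Space (n + 1) → E} (hf : LocallyIntegrable f)
    (i : Fin (n + 1)) {K : Set (ℝ × (Fin n → ℝ))} (hK : IsCompact K) :
    IntegrableOn (fun z ↦ f (slicePoint i z)) K (volume.prod volume) := by
  have h1 := hf.integrableOn_isCompact (hK.image (continuous_slicePoint i))
  rw [← (measurePreserving_slicePoint i).integrableOn_comp_preimage
    (measurableEmbedding_slicePoint i)] at h1
  exact h1.mono_set (Set.subset_preimage_image _ _)

/-- Fubini on a countable exhaustion by compact boxes, so that a single null set of lines is
discarded. -/
lemma ae_locallyIntegrable_slice {f : Space (n + 1) → E} (hf : LocallyIntegrable f)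
    (i : Fin (n + 1)) : ∀ᵐ y : Fin n → ℝ, LocallyIntegrable fun s ↦ f (slicePoint i (s, y)) := by
  have h1 : ∀ m : ℕ, ∀ᵐ y : Fin n → ℝ, y ∈ Metric.closedBall 0 (m : ℝ) →
      IntegrableOn (fun s ↦ f (slicePoint i (s, y))) (Set.Icc (-m : ℝ) m) := by
    intro m
    have h2 := integrableOn_comp_slicePoint hf i
      ((isCompact_Icc (a := -(m : ℝ)) (b := m)).prod (isCompact_closedBall (0 : Fin n → ℝ) m))
    rw [IntegrableOn, ← Measure.prod_restrict] at h2
    exact (ae_restrict_iff' Metric.isClosed_closedBall.measurableSet).1 h2.prod_left_ae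
  filter_upwards [ae_all_iff.2 h1] with y hy
  rw [locallyIntegrable_iff]
  intro K hK
  obtain ⟨M, hM⟩ := hK.isBounded.subset_closedBall 0
  obtain ⟨m, hm⟩ := exists_nat_ge (max M ‖y‖)
  refine (hy m ?_).mono_set fun s hs ↦ ?_
  · simpa using (le_max_right _ _).trans hm
  · have := hM hs
    rw [mem_closedBall_zero_iff, Real.norm_eq_abs] at this
    exact abs_le.1 (this.trans ((le_max_left _ _).trans hm))

/-- Products of test functions. -/
noncomputable def tensorTest (i : Fin (n + 1)) (α : ℝ → ℝ) (β : (Fin n → ℝ) → ℝ)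
    (x : Space (n + 1)) : ℝ := α (x i) * β fun j ↦ x (i.succAbove j)

lemma tensorTest_slicePoint (i : Fin (n + 1)) (α : ℝ → ℝ) (β : (Fin n → ℝ) → ℝ)
    (z : ℝ × (Fin n → ℝ)) : tensorTest i α β (slicePoint i z) = α z.1 * β z.2 := by
  simp [tensorTest]

lemma contDiff_tensorTest (i : Fin (n + 1)) {α : ℝ → ℝ} (hα : ContDiff ℝ ∞ α)
    {β : (Fin n → ℝ) → ℝ} (hβ : ContDiff ℝ ∞ β) : ContDiff ℝ ∞ (tensorTest i α β) := by
  unfold tensorTest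
  fun_prop

lemma hasCompactSupport_tensorTest (i : Fin (n + 1)) {α : ℝ → ℝ} (hα : HasCompactSupport α)
    {β : (Fin n → ℝ) → ℝ} (hβ : HasCompactSupport β) : HasCompactSupport (tensorTest i α β) := by
  refine HasCompactSupport.intro ((hα.isCompact.prod hβ.isCompact).image (continuous_slicePoint i))
    fun x hx ↦ ?_
  by_contra h0
  refine hx ⟨(x i, fun j ↦ x (i.succAbove j)), ⟨subset_closure ?_, subset_closure ?_⟩, ?_⟩
  · exact left_ne_zero_of_mul h0
  · exact right_ne_zero_of_mul h0
  · ext j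
    refine Fin.succAboveCases i ?_ (fun k ↦ ?_) j <;> simp

lemma fderiv_tensorTest (i : Fin (n + 1)) {α : ℝ → ℝ} (hα : ContDiff ℝ ∞ α)
    {β : (Fin n → ℝ) → ℝ} (hβ : ContDiff ℝ ∞ β) (x : Space (n + 1)) :
    fderiv ℝ (tensorTest i α β) x (EuclideanSpace.single i 1) = tensorTest i (deriv α) β x := by
  have hd : DifferentiableAt ℝ (tensorTest i α β) x :=
    (contDiff_tensorTest i hα hβ).differentiable (by simp) x
  rw [← hd.lineDeriv_eq_fderiv]
  have h1 : ∀ t : ℝ, tensorTest i α β (x + t • EuclideanSpace.single i 1) =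
      α (x i + t) * β fun j ↦ x (i.succAbove j) := by
    intro t
    simp [tensorTest]
  rw [lineDeriv]
  simp_rw [h1]
  rw [deriv_mul_const_field, deriv_comp_const_add, add_zero, tensorTest]

variable [NormedSpace ℝ E] [CompleteSpace E]

/-- Test against products `α ⊗ β`. By Fubini the line integral, as a function of `y`, is orthogonal
to every `β`, hence vanishes almost everywhere. The null set depends on `α`. -/
lemma IsWeakPartial.ae_integral_deriv_smul {i : Fin (n + 1)} {u g : Space (n + 1) → E}
    (h : IsWeakPartial i u g) {α : ℝ → ℝ} (hα : ContDiff ℝ ∞ α) (hαc : HasCompactSupport α) :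
    ∀ᵐ y : Fin n → ℝ, ∫ s, (deriv α s • u (slicePoint i (s, y)) + α s • g (slicePoint i (s, y))) = 0
    := by
  obtain ⟨hu, hg, hw⟩ := h
  have hα' : ContDiff ℝ ∞ (deriv α) := (contDiff_infty_iff_deriv.1 hα).2
  have hint : ∀ β : (Fin n → ℝ) → ℝ, ContDiff ℝ ∞ β → HasCompactSupport β →
      Integrable (fun x ↦ tensorTest i (deriv α) β x • u x) ∧
      Integrable (fun x ↦ tensorTest i α β x • g x) := fun β hβ hβc ↦
    ⟨hu.integrable_smul_left_of_hasCompactSupport (contDiff_tensorTest i hα' hβ).continuous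
      (hasCompactSupport_tensorTest i hαc.deriv hβc),
      hg.integrable_smul_left_of_hasCompactSupport (contDiff_tensorTest i hα hβ).continuous
      (hasCompactSupport_tensorTest i hαc hβc)⟩
  set Φ : ((Fin n → ℝ) → ℝ) → ℝ × (Fin n → ℝ) → E := fun β z ↦
    β z.2 • (deriv α z.1 • u (slicePoint i z) + α z.1 • g (slicePoint i z)) with hΦ
  have hΦeq : ∀ β, Φ β = (fun x ↦ tensorTest i (deriv α) β x • u x + tensorTest i α β x • g x) ∘
      slicePoint i := fun β ↦ funext fun z ↦ by
    simp only [hΦ, Function.comp, tensorTest_slicePoint, smul_add, smul_smul]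
    rw [mul_comm, mul_comm (β z.2)]
  have hΦi : ∀ β : (Fin n → ℝ) → ℝ, ContDiff ℝ ∞ β → HasCompactSupport β →
      Integrable (Φ β) (volume.prod volume) := by
    intro β hβ hβc
    obtain ⟨h1, h2⟩ := hint β hβ hβc
    rw [hΦeq, (measurePreserving_slicePoint i).integrable_comp_emb
      (measurableEmbedding_slicePoint i)]
    exact h1.add h2
  refine ae_eq_zero_of_integral_contDiff_smul_eq_zero (fun y ↦ ?_) fun β hβ hβc ↦ ?_
  -- Local integrability in `y`: the integrable function obtained from a bump equal to `1` near `y`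
  -- coincides there with the line integral.
  · let b : ContDiffBump y := ⟨1, 2, one_pos, one_lt_two⟩
    have h1 := (hΦi b b.contDiff b.hasCompactSupport).integral_prod_right
    refine ⟨Metric.closedBall y 1, Metric.closedBall_mem_nhds y one_pos, ?_⟩
    refine h1.integrableOn.congr_fun (fun y' hy' ↦ ?_) Metric.isClosed_closedBall.measurableSet
    simp only [hΦ, b.one_of_mem_closedBall hy', one_smul]
  · obtain ⟨h1, h2⟩ := hint β hβ hβc
    have h3 : ∫ z, Φ β z ∂(volume.prod volume) =
        ∫ x, (tensorTest i (deriv α) β x • u x + tensorTest i α β x • g x) := by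
      rw [hΦeq]
      exact (measurePreserving_slicePoint i).integral_comp (measurableEmbedding_slicePoint i)
        fun x ↦ tensorTest i (deriv α) β x • u x + tensorTest i α β x • g x
    rw [integral_prod_symm (Φ β) (hΦi β hβ hβc), integral_add h1 h2] at h3
    have h4 := hw _ (contDiff_tensorTest i hα hβ) (hasCompactSupport_tensorTest i hαc hβc)
    simp_rw [fderiv_tensorTest i hα hβ] at h4
    rw [h4, neg_add_cancel] at h3
    rw [← h3]
    refine integral_congr_ae (ae_of_all _ fun y ↦ ?_)
    simp only [hΦ]
    exact (integral_smul (β y) fun s ↦ deriv α s • u (slicePoint i (s, y)) +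
      α s • g (slicePoint i (s, y))).symm

/-- On almost every line parallel to the `i`-th axis, a function with a weak partial derivative in
that direction is a primitive of it. -/
theorem IsWeakPartial.ae_exists_ae_eq_primitive {i : Fin (n + 1)} {u g : Space (n + 1) → E}
    (h : IsWeakPartial i u g) : ∀ᵐ y : Fin n → ℝ, ∃ k, ∀ᵐ s, u (slicePoint i (s, y)) =
      k + ∫ t in (0 : ℝ)..s, g (slicePoint i (t, y)) := by
  -- The family of test functions is countable, so one null set of lines serves all of them.
  have h1 : ∀ᵐ y : Fin n → ℝ, ∀ (m : ℕ) (p q : ℚ),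
      ∫ s, (deriv (bumpPrimitive m p q) s • u (slicePoint i (s, y)) +
        bumpPrimitive m p q s • g (slicePoint i (s, y))) = 0 := by
    simp_rw [ae_all_iff]
    exact fun m p q ↦ h.ae_integral_deriv_smul (contDiff_bumpPrimitive m p q)
      (hasCompactSupport_bumpPrimitive m p q)
  filter_upwards [h1, ae_locallyIntegrable_slice h.1 i, ae_locallyIntegrable_slice h.2.1 i]
    with y hy hu hg
  refine exists_ae_eq_const_add_primitive hu hg fun m p q ↦ ?_
  have hc := contDiff_bumpPrimitive m p q
  have hcc := hasCompactSupport_bumpPrimitive m p q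
  have := hy m p q
  rw [integral_add (hu.integrable_smul_left_of_hasCompactSupport (hc.continuous_deriv (by simp))
    hcc.deriv) (hg.integrable_smul_left_of_hasCompactSupport hc.continuous hcc)] at this
  exact eq_neg_of_add_eq_zero_left this

end Slices

/-! ### Translations of square integrable functions -/

section Translation

/-- Translations act continuously on square integrable functions. -/
lemma tendsto_lintegral_enorm_translate_sub {G E : Type*} [NormedAddCommGroup G]
    [InnerProductSpace ℝ G] [FiniteDimensional ℝ G] [MeasurableSpace G] [BorelSpace G]
    [NormedAddCommGroup E] {f : G → E} (hf : MemLp f 2) :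
    Tendsto (fun a : G ↦ ∫⁻ x, ‖f (x + a) - f x‖ₑ ^ 2) (𝓝 0) (𝓝 0) := by
  let τ : C(G, C(G, G)) := ContinuousMap.curry ⟨fun p : G × G ↦ p.2 + p.1, by fun_prop⟩
  have hτ : ∀ a x, τ a x = x + a := fun a x ↦ rfl
  have hmp : ∀ a : G, MeasurePreserving (τ a) volume volume := fun a ↦
    measurePreserving_add_right volume a
  have h2 : (2 : ℝ≥0∞) ≠ ⊤ := by simp
  have hcont := (continuous_const (y := hf.toLp f)).compMeasurePreservingLp τ.continuous
    (μ := volume) (fun a ↦ hmp a) h2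
  have h0 := hcont.tendsto 0
  rw [tendsto_iff_edist_tendsto_0] at h0
  have heq : ∀ a, edist (Lp.compMeasurePreserving (τ a) (hmp a) (hf.toLp f))
      (Lp.compMeasurePreserving (τ 0) (hmp 0) (hf.toLp f)) =
      eLpNorm (fun x ↦ f (x + a) - f x) 2 volume := by
    intro a
    rw [Lp.toLp_compMeasurePreserving, Lp.toLp_compMeasurePreserving, Lp.edist_toLp_toLp]
    congr 1
    ext x
    simp [hτ]
  simp only [heq] at h0
  have h3 := (ENNReal.continuous_pow 2).tendsto 0 |>.comp h0
  rw [zero_pow two_ne_zero] at h3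
  refine h3.congr fun a ↦ ?_
  simp only [Function.comp]
  rw [eLpNorm_eq_lintegral_rpow_enorm_toReal two_ne_zero h2]
  rw [← ENNReal.rpow_natCast, ← ENNReal.rpow_mul]
  simp

lemma sq_lintegral_le {α : Type*} [MeasurableSpace α] (μ : Measure α) {f : α → ℝ≥0∞}
    (hf : AEMeasurable f μ) : (∫⁻ x, f x ∂μ) ^ 2 ≤ μ Set.univ * ∫⁻ x, f x ^ 2 ∂μ := by
  have h := ENNReal.lintegral_mul_le_Lp_mul_Lq μ Real.HolderConjugate.two_two hf
    (aemeasurable_const (b := (1 : ℝ≥0∞)))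
  simp only [Pi.mul_apply, mul_one, ENNReal.one_rpow, lintegral_const, one_mul] at h
  calc (∫⁻ x, f x ∂μ) ^ 2 ≤
      ((∫⁻ x, f x ^ (2 : ℝ) ∂μ) ^ (1 / (2 : ℝ)) * μ Set.univ ^ (1 / (2 : ℝ))) ^ 2 := by gcongr
    _ = μ Set.univ * ∫⁻ x, f x ^ 2 ∂μ := by
      rw [mul_pow, ← ENNReal.rpow_natCast, ← ENNReal.rpow_natCast, ← ENNReal.rpow_mul,
        ← ENNReal.rpow_mul, mul_comm]
      simp

variable {E : Type*} [NormedAddCommGroup E] [NormedSpace ℝ E]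

/-- Cauchy-Schwarz on an interval of length `h` gives one factor `h`; Tonelli and translation
invariance give the other. -/
lemma lintegral_enorm_integral_sq_le {g : ℝ → E} (hg : StronglyMeasurable g) {h : ℝ}
    (hh : 0 ≤ h) : ∫⁻ s, ‖∫ t in s..(s + h), g t‖ₑ ^ 2 ≤
      ENNReal.ofReal h ^ 2 * ∫⁻ s, ‖g s‖ₑ ^ 2 := by
  have hm : Measurable fun s ↦ ‖g s‖ₑ ^ 2 := hg.enorm.pow_const 2
  have h1 : ∀ s, ‖∫ t in s..(s + h), g t‖ₑ ^ 2 ≤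
      ENNReal.ofReal h * ∫⁻ t in Set.Ioc 0 h, ‖g (s + t)‖ₑ ^ 2 := by
    intro s
    have h2 : ∫ t in s..(s + h), g t = ∫ t in Set.Ioc 0 h, g (s + t) := by
      rw [← intervalIntegral.integral_of_le hh, intervalIntegral.integral_comp_add_left, add_zero]
    calc ‖∫ t in s..(s + h), g t‖ₑ ^ 2 ≤ (∫⁻ t in Set.Ioc 0 h, ‖g (s + t)‖ₑ) ^ 2 := by
          rw [h2]; gcongr; exact enorm_integral_le_lintegral_enorm _
      _ ≤ _ := by
          refine (sq_lintegral_le _ ?_).trans_eq ?_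
          · exact (hg.comp_measurable (measurable_const_add s)).enorm.aemeasurable
          · simp
  calc ∫⁻ s, ‖∫ t in s..(s + h), g t‖ₑ ^ 2
      ≤ ∫⁻ s, ENNReal.ofReal h * ∫⁻ t in Set.Ioc 0 h, ‖g (s + t)‖ₑ ^ 2 := lintegral_mono h1
    _ = ENNReal.ofReal h * ∫⁻ s, ∫⁻ t in Set.Ioc 0 h, ‖g (s + t)‖ₑ ^ 2 :=
        lintegral_const_mul' _ _ ENNReal.ofReal_ne_top
    _ = ENNReal.ofReal h * ∫⁻ t in Set.Ioc 0 h, ∫⁻ s, ‖g (s + t)‖ₑ ^ 2 := by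
        rw [lintegral_lintegral_swap]
        exact (hm.comp (measurable_fst.add measurable_snd)).aemeasurable
    _ = ENNReal.ofReal h ^ 2 * ∫⁻ s, ‖g s‖ₑ ^ 2 := by
        simp_rw [lintegral_add_right_eq_self (μ := (volume : Measure ℝ)) fun s ↦ ‖g s‖ₑ ^ 2]
        rw [lintegral_const, mul_comm (∫⁻ s, _), ← mul_assoc]
        simp [sq]

lemma lintegral_enorm_translate_sub_sq_le {f g : ℝ → E} (hg : LocallyIntegrable g) {k : E}
    (hf : ∀ᵐ s, f s = k + ∫ t in (0 : ℝ)..s, g t) {h : ℝ} (hh : 0 ≤ h) :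
    ∫⁻ s, ‖f (s + h) - f s‖ₑ ^ 2 ≤ ENNReal.ofReal h ^ 2 * ∫⁻ s, ‖g s‖ₑ ^ 2 := by
  have hgi : ∀ a b, IntervalIntegrable g volume a b := fun a b ↦
    (hg.integrableOn_isCompact isCompact_uIcc).intervalIntegrable
  obtain ⟨g', hg', hgg'⟩ := hg.aestronglyMeasurable
  have hf' := (measurePreserving_add_right volume h).quasiMeasurePreserving.ae hf
  have h1 : ∫⁻ s, ‖f (s + h) - f s‖ₑ ^ 2 = ∫⁻ s, ‖∫ t in s..(s + h), g' t‖ₑ ^ 2 := by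
    refine lintegral_congr_ae ?_
    filter_upwards [hf, hf'] with s h1 h2
    rw [h1, h2, add_sub_add_left_eq_sub,
      intervalIntegral.integral_interval_sub_left (hgi _ _) (hgi _ _)]
    congr 2
    exact intervalIntegral.integral_congr_ae (hgg'.mono fun t ht _ ↦ ht)
  rw [h1, lintegral_congr_ae (hgg'.mono fun s hs ↦ by simp only [hs] :
    (fun s ↦ ‖g s‖ₑ ^ 2) =ᵐ[volume] fun s ↦ ‖g' s‖ₑ ^ 2)]
  exact lintegral_enorm_integral_sq_le hg' hh

variable {n : ℕ}

lemma lintegral_slicePoint (i : Fin (n + 1)) {f : Space (n + 1) → ℝ≥0∞} (hf : AEMeasurable f) :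
    ∫⁻ x, f x = ∫⁻ y : Fin n → ℝ, ∫⁻ s, f (slicePoint i (s, y)) := by
  rw [← (measurePreserving_slicePoint i).lintegral_comp_emb (measurableEmbedding_slicePoint i),
    lintegral_prod_symm]
  exact hf.comp_quasiMeasurePreserving (measurePreserving_slicePoint i).quasiMeasurePreserving

/-- The difference quotients of a function in the direction of the `i`-th axis are controlled by its
weak partial derivative. -/
theorem IsWeakPartial.lintegral_translate_sub_le [CompleteSpace E] {i : Fin (n + 1)}
    {u g : Space (n + 1) → E} (hu : IsWeakPartial i u g) {h : ℝ} (hh : 0 ≤ h) :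
    ∫⁻ x, ‖u (x + h • EuclideanSpace.single i 1) - u x‖ₑ ^ 2 ≤
      ENNReal.ofReal h ^ 2 * ∫⁻ x, ‖g x‖ₑ ^ 2 := by
  have hum := hu.1.aestronglyMeasurable
  have hum' : AEStronglyMeasurable fun x ↦ u (x + h • EuclideanSpace.single i 1) :=
    hum.comp_measurePreserving (measurePreserving_add_right volume _)
  have hd : AEMeasurable fun x ↦ ‖u (x + h • EuclideanSpace.single i 1) - u x‖ₑ ^ 2 :=
    (hum'.sub hum).enorm.pow_const 2
  rw [lintegral_slicePoint i hd,
    lintegral_slicePoint i (hu.2.1.aestronglyMeasurable.enorm.pow_const 2),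
    ← lintegral_const_mul' _ _ (by finiteness)]
  refine lintegral_mono_ae ?_
  filter_upwards [hu.ae_exists_ae_eq_primitive, ae_locallyIntegrable_slice hu.2.1 i]
    with y ⟨k, hk⟩ hg
  have := lintegral_enorm_translate_sub_sq_le hg hk hh
  simpa only [← slicePoint_single_left, ← slicePoint_add, Prod.mk_add_mk, add_zero] using this

end Translation

/-! ### Sets which are almost invariant under translations -/

section Invariant

variable {m : ℕ} {A : Set (Fin (m + 1) → ℝ)}

/-- A set of finite measure invariant under a unit translation, up to null sets, is null. -/
lemma measure_eq_zero_of_ae_translate_iff (hA : NullMeasurableSet A) (hfin : volume A ≠ ⊤)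
    (hinv : ∀ᵐ y, y ∈ A ↔ y + Pi.single 0 1 ∈ A) : volume A = 0 := by
  -- Cut `A` into unit slabs. The translation carries each slab to the next, so infinitely many
  -- pieces of equal measure have a finite sum.
  set B : ℤ → Set (Fin (m + 1) → ℝ) := fun k ↦ A ∩ {y | ⌊y 0⌋ = k} with hB
  have hSm : ∀ k : ℤ, MeasurableSet {y : Fin (m + 1) → ℝ | ⌊y 0⌋ = k} := fun k ↦
    (Int.measurable_floor.comp (measurable_pi_apply 0)) (measurableSet_singleton k)
  have hstep : ∀ k, volume (B (k + 1)) = volume (B k) := by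
    intro k
    rw [← measure_preimage_add_right volume (Pi.single 0 1) (B (k + 1))]
    refine measure_congr ?_
    filter_upwards [hinv] with y hy
    refine propext ⟨fun h ↦ ⟨hy.2 h.1, ?_⟩, fun h ↦ ⟨hy.1 h.1, ?_⟩⟩
    · have := h.2
      simpa using this
    · have := h.2
      simp only [Set.mem_ofPred_eq] at this
      simp [this]
  have hconst : ∀ k, volume (B k) = volume (B 0) := by
    intro k
    induction k using Int.induction_on with
    | zero => rfl
    | succ i ih => rw [hstep, ih]
    | pred i ih => rw [← hstep, sub_add_cancel, ih]
  have hunion : A = ⋃ k, B k := by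
    ext y
    simp [hB]
  have hdisj : Pairwise (Function.onFun (AEDisjoint volume) B) := by
    intro j k hjk
    refine Disjoint.aedisjoint (Set.disjoint_left.2 fun y hj hk ↦ hjk ?_)
    exact hj.2.symm.trans hk.2
  have hsum : volume A = ∑' _ : ℤ, volume (B 0) := by
    conv_lhs => rw [hunion]
    rw [measure_iUnion₀ hdisj fun k ↦ hA.inter (hSm k).nullMeasurableSet]
    simp_rw [hconst]
  by_cases h0 : volume (B 0) = 0
  · rw [hsum, h0, tsum_zero]
  · exact absurd (hsum.trans (ENNReal.tsum_const_eq_top_of_ne_zero h0)) hfin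

/-- The measure of the set of points which a translation moves across the boundary of `A` is
subadditive in the translation. -/
lemma measure_translate_not_iff_le (n : ℕ) (h : ℝ) :
    volume {y | ¬(y ∈ A ↔ y + Pi.single 0 (n * h) ∈ A)} ≤
      n * volume {y | ¬(y ∈ A ↔ y + Pi.single 0 h ∈ A)} := by
  induction n with
  | zero => simp
  | succ n ih =>
    have hsub : {y | ¬(y ∈ A ↔ y + Pi.single 0 ((n + 1 : ℕ) * h) ∈ A)} ⊆
        {y | ¬(y ∈ A ↔ y + Pi.single 0 (n * h) ∈ A)} ∪
          (fun y ↦ y + Pi.single 0 (n * h)) ⁻¹' {y | ¬(y ∈ A ↔ y + Pi.single 0 h ∈ A)} := by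
      intro y hy
      have : y + Pi.single 0 ((n + 1 : ℕ) * h) = y + Pi.single 0 (n * h) + Pi.single 0 h := by
        rw [add_assoc, ← Pi.single_add]; congr 2; push_cast; ring
      simp only [Set.mem_ofPred_eq, Set.mem_union, Set.mem_preimage, this] at hy ⊢
      tauto
    refine (measure_mono hsub).trans ((measure_union_le _ _).trans ?_)
    rw [measure_preimage_add_right]
    push_cast
    rw [add_mul, one_mul]
    gcongr

end Invariant

/-! ### Solutions of the travelling wave equation on lines -/

section GoodSlice

variable {r₀ c : ℝ} {φ F : ℝ → ℝ}

/-- `r₀ - v` has a representative on the line, with derivative represented by `-g`, which is a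
profile of finite energy. -/
def IsRegularSlice (r₀ : ℝ) (φ F : ℝ → ℝ) (c : ℝ) (v g : ℝ → ℂ) : Prop :=
  ∃ u u' : ℝ → ℂ, (∀ s, HasDerivAt u (u' s) s) ∧ Continuous u' ∧
    IsProfile F c (fun s ↦ (u s).re) (fun s ↦ (u s).im) (fun s ↦ (u' s).re) (fun s ↦ (u' s).im) ∧
    Integrable (fun s ↦ (u' s).re ^ 2 + (u' s).im ^ 2 +
      (φ √((u s).re ^ 2 + (u s).im ^ 2) ^ 2 - r₀ ^ 2) ^ 2) ∧
    (∀ᵐ s, v s = r₀ - u s) ∧ ∀ᵐ s, g s = -u' s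

lemma sqrt_re_sq_add_im_sq (z : ℂ) : √(z.re ^ 2 + z.im ^ 2) = ‖z‖ := by
  rw [Complex.norm_def, Complex.normSq_apply, sq, sq]

lemma re_sq_add_im_sq (z : ℂ) : z.re ^ 2 + z.im ^ 2 = ‖z‖ ^ 2 := by
  rw [Complex.sq_norm, Complex.normSq_apply, sq, sq]

lemma hasDerivAt_complex_re {f : ℝ → ℂ} {f' : ℂ} {s : ℝ} (h : HasDerivAt f f' s) :
    HasDerivAt (fun s ↦ (f s).re) f'.re s :=
  Complex.reCLM.hasFDerivAt.comp_hasDerivAt s h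

lemma hasDerivAt_complex_im {f : ℝ → ℂ} {f' : ℂ} {s : ℝ} (h : HasDerivAt f f' s) :
    HasDerivAt (fun s ↦ (f s).im) f'.im s :=
  Complex.imCLM.hasFDerivAt.comp_hasDerivAt s h

/-- Bootstrap: `g` agrees almost everywhere with a continuous primitive `W`, so `v` has a `C¹`
representative `U`. Substituting both makes the right side of the equation continuous, so `W` is
`C¹` and the equation holds pointwise. -/
lemma isRegularSlice_of_ae_eq_primitive (hF : Continuous F) {v g : ℝ → ℂ}
    {k₀ k₁ : ℂ} (hv : ∀ᵐ s, v s = k₀ + ∫ t in (0 : ℝ)..s, g t)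
    (hG : LocallyIntegrable fun s ↦ Complex.I * c * g s + F (‖r₀ - v s‖ ^ 2) * (r₀ - v s))
    (hgG : ∀ᵐ s, g s = k₁ + ∫ t in (0 : ℝ)..s,
      (Complex.I * c * g t + F (‖r₀ - v t‖ ^ 2) * (r₀ - v t)))
    (hg2 : Integrable fun s ↦ ‖g s‖ ^ 2)
    (hφ2 : Integrable fun s ↦ (φ ‖r₀ - v s‖ ^ 2 - r₀ ^ 2) ^ 2) :
    IsRegularSlice r₀ φ F c v g := by
  set W : ℝ → ℂ := fun s ↦ k₁ + ∫ t in (0 : ℝ)..s,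
      (Complex.I * c * g t + F (‖r₀ - v t‖ ^ 2) * (r₀ - v t)) with hW
  replace hgG : ∀ᵐ s, g s = W s := hgG
  have hWc : Continuous W := continuous_const.add (intervalIntegral.continuous_primitive
    (fun a b ↦ (hG.integrableOn_isCompact isCompact_uIcc).intervalIntegrable) 0)
  have hU : ∀ s, ∫ t in (0 : ℝ)..s, g t = ∫ t in (0 : ℝ)..s, W t := fun s ↦
    intervalIntegral.integral_congr_ae (hgG.mono fun t ht _ ↦ ht)
  set U : ℝ → ℂ := fun s ↦ k₀ + ∫ t in (0 : ℝ)..s, W t with hUdef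
  simp only [hU] at hv
  replace hv : ∀ᵐ s, v s = U s := hv
  have hUd : ∀ s, HasDerivAt U (W s) s := fun s ↦
    ((hWc.integral_hasStrictDerivAt 0 s).hasDerivAt).const_add k₀
  have hUc : Continuous U := continuous_iff_continuousAt.2 fun s ↦ (hUd s).continuousAt
  set H : ℝ → ℂ := fun s ↦ Complex.I * c * W s + F (‖r₀ - U s‖ ^ 2) * (r₀ - U s) with hH
  have hHc : Continuous H := by fun_prop
  have hW2 : ∀ s, W s = k₁ + ∫ t in (0 : ℝ)..s, H t := by
    intro s
    simp only [hW]
    congr 1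
    refine intervalIntegral.integral_congr_ae ?_
    filter_upwards [hv, hgG] with t h1 h2 _
    rw [h2, h1]
  have hWd : ∀ s, HasDerivAt W (H s) s := fun s ↦ by
    rw [show W = fun s ↦ k₁ + ∫ t in (0 : ℝ)..s, H t from funext hW2]
    exact ((hHc.integral_hasStrictDerivAt 0 s).hasDerivAt).const_add k₁
  have hu : ∀ s, HasDerivAt (fun s ↦ r₀ - U s) (-W s) s := fun s ↦ (hUd s).const_sub _
  have hu' : ∀ s, HasDerivAt (fun s ↦ -W s) (-H s) s := fun s ↦ (hWd s).neg
  refine ⟨fun s ↦ r₀ - U s, fun s ↦ -W s, hu, hWc.neg, ⟨fun s ↦ hasDerivAt_complex_re (hu s),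
    fun s ↦ hasDerivAt_complex_im (hu s), fun s ↦ ?_, fun s ↦ ?_⟩, ?_, ?_, ?_⟩
  · refine (hasDerivAt_complex_re (hu' s)).congr_deriv ?_
    rw [re_sq_add_im_sq]
    simp only [hH, Complex.neg_re, Complex.neg_im, Complex.add_re, Complex.mul_re, Complex.mul_im,
      Complex.I_re, Complex.I_im, Complex.ofReal_re, Complex.ofReal_im]
    ring
  · refine (hasDerivAt_complex_im (hu' s)).congr_deriv ?_
    rw [re_sq_add_im_sq]
    simp only [hH, Complex.neg_re, Complex.neg_im, Complex.add_im, Complex.mul_re, Complex.mul_im,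
      Complex.I_re, Complex.I_im, Complex.ofReal_re, Complex.ofReal_im]
    ring
  · refine (hg2.add hφ2).congr ?_
    filter_upwards [hv, hgG] with s h1 h2
    rw [Pi.add_apply, sqrt_re_sq_add_im_sq, re_sq_add_im_sq, norm_neg, h1, h2]
  · filter_upwards [hv] with s hs
    rw [hs, sub_sub_cancel]
  · filter_upwards [hgG] with s hs
    rw [hs, neg_neg]

variable {v g v₁ g₁ : ℝ → ℂ} {l : ℝ}

/-- If one slice is trivial and the other one is not, they are far apart. -/
lemma IsRegularSlice.le_lintegral (hφ : IsTruncation r₀ φ) (hr₀ : 0 < r₀) (hF : Continuous F)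
    (hl : ∀ s, s ≠ r₀ ^ 2 → |s - r₀ ^ 2| < l →
      c ^ 2 * (s - r₀ ^ 2) ^ 2 < 4 * s * potential r₀ F s)
    (h : IsRegularSlice r₀ φ F c v g) (h₁ : IsRegularSlice r₀ φ F c v₁ g₁)
    (hg : ∫⁻ s, ‖g s‖ₑ ^ 2 ≠ 0) (hg₁ : ∫⁻ s, ‖g₁ s‖ₑ ^ 2 = 0) {ε : ℝ} (hε : 0 < ε) {d : ℝ}
    (hd : ∀ x, 0 ≤ x → l ≤ |x ^ 2 - r₀ ^ 2| → d ≤ |x - r₀|) :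
    ENNReal.ofReal d ^ 2 ≤ ENNReal.ofReal ε⁻¹ * (∫⁻ s, ‖v₁ s - v s‖ₑ ^ 2) +
      ENNReal.ofReal ε * ∫⁻ s, ‖g₁ s - g s‖ₑ ^ 2 := by
  obtain ⟨u, u', hu, huc, hp, hE, hvu, hgu⟩ := h
  obtain ⟨w, w', hw, hwc, hq, hE₁, hvw, hgw⟩ := h₁
  have hw0 : ∀ s, w' s = 0 := by
    have : w' = fun _ ↦ 0 := by
      refine Measure.eq_of_ae_eq (μ := volume) ?_ hwc continuous_const
      have h0 : ∫⁻ s, ‖w' s‖ₑ ^ 2 = 0 := by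
        rw [← hg₁]
        exact lintegral_congr_ae (hgw.mono fun s hs ↦ by simp only [hs, enorm_neg])
      rw [lintegral_eq_zero_iff (hwc.enorm.measurable.pow_const 2)] at h0
      exact h0.mono fun s hs ↦ by simpa using hs
    exact congrFun this
  obtain ⟨x, -, hx⟩ := exists_seq_tendsto_zero_atTop hE₁ fun s ↦ by positivity
  -- The second slice is constant, and finite energy leaves only the modulus `r₀`.
  have hwr : ∀ s, ‖w s‖ = r₀ := by
    intro s
    have hc : ∀ t, w t = w s := fun t ↦ is_const_of_deriv_eq_zero
      (fun s ↦ (hw s).differentiableAt) (fun s ↦ by rw [(hw s).deriv, hw0]) t s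
    have := (tendsto_sq_add_sq hφ hr₀ hx).1
    simp only [hc, re_sq_add_im_sq] at this
    exact (sq_eq_sq₀ (norm_nonneg _) hr₀.le).1 (tendsto_nhds_unique tendsto_const_nhds this)
  -- The first slice is not trivial, so at some point its modulus is at distance at least `d` from
  -- `r₀`; interpolation at that point bounds the `L²` distances from below.
  rcases hp.trivial_or_exists_le hF hφ hr₀ hE hl with ht | ⟨s, hs⟩
  · refine absurd ?_ hg
    have : ∀ᵐ s, ‖g s‖ₑ ^ 2 = 0 := hgu.mono fun s hs ↦ by
      have : u' s = 0 := Complex.ext (ht s).1 (ht s).2.1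
      simp [hs, this]
    rw [lintegral_congr_ae this, lintegral_zero]
  · rw [re_sq_add_im_sq] at hs
    have hds := hd _ (norm_nonneg _) hs
    have h1 : ENNReal.ofReal d ≤ ‖u s - w s‖ₑ := by
      rw [← ofReal_norm]
      refine ENNReal.ofReal_le_ofReal (hds.trans ?_)
      rw [← hwr s]
      exact abs_norm_sub_norm_le _ _
    have h2 := enorm_sq_le_lintegral_add_lintegral (f := fun s ↦ u s - w s)
      (fun s ↦ (hu s).sub (hw s)) (huc.sub hwc) hε s
    calc ENNReal.ofReal d ^ 2 ≤ ‖u s - w s‖ₑ ^ 2 := by gcongr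
      _ ≤ _ := h2
      _ = _ := by
        congr 2
        · refine lintegral_congr_ae ?_
          filter_upwards [hvu, hvw] with s h3 h4
          rw [h3, h4, sub_sub_sub_cancel_left]
        · refine lintegral_congr_ae ?_
          filter_upwards [hgu, hgw] with s h3 h4
          rw [h3, h4, neg_sub_neg]

/-- A nontrivial slice carries a minimal energy. -/
lemma IsRegularSlice.arctan_sq_le (hφ : IsTruncation r₀ φ) (hr₀ : 0 < r₀) (hF : Continuous F)
    (hl0 : 0 ≤ l) (hl : ∀ s, s ≠ r₀ ^ 2 → |s - r₀ ^ 2| < l →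
      c ^ 2 * (s - r₀ ^ 2) ^ 2 < 4 * s * potential r₀ F s)
    (h : IsRegularSlice r₀ φ F c v g) (hg : ∫⁻ s, ‖g s‖ₑ ^ 2 ≠ 0) :
    ENNReal.ofReal (Real.arctan l ^ 2) ≤
      ENNReal.ofReal ((1 + 1 / r₀ ^ 2) ^ 2 + 4 * (1 + r₀ ^ 2)) *
      ∫⁻ s, (‖g s‖ₑ ^ 2 + ‖φ ‖r₀ - v s‖ ^ 2 - r₀ ^ 2‖ₑ ^ 2) := by
  obtain ⟨u, u', hu, huc, hp, hE, hvu, hgu⟩ := h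
  rcases hp.trivial_or_exists_le hF hφ hr₀ hE hl with ht | ⟨s, hs⟩
  · refine absurd ?_ hg
    have : ∀ᵐ s, ‖g s‖ₑ ^ 2 = 0 := hgu.mono fun s hs ↦ by
      have : u' s = 0 := Complex.ext (ht s).1 (ht s).2.1
      simp [hs, this]
    rw [lintegral_congr_ae this, lintegral_zero]
  · have h1 := hp.arctan_sq_le hφ hr₀ hE hl0 hs
    refine (ENNReal.ofReal_le_ofReal h1).trans_eq ?_
    rw [ENNReal.ofReal_mul (by positivity),
      ofReal_integral_eq_lintegral_ofReal hE (ae_of_all _ fun s ↦ by positivity)]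
    congr 1
    refine lintegral_congr_ae ?_
    filter_upwards [hvu, hgu] with s h2 h3
    rw [h2, h3, re_sq_add_im_sq, sqrt_re_sq_add_im_sq, sub_sub_cancel, enorm_neg,
      ENNReal.ofReal_add (by positivity) (by positivity), ENNReal.ofReal_pow (norm_nonneg _),
      ofReal_norm, ← sq_abs (φ ‖u s‖ ^ 2 - r₀ ^ 2), ENNReal.ofReal_pow (abs_nonneg _),
      ← Real.norm_eq_abs, ofReal_norm]

end GoodSlice

/-! ### Rigidity of weak solutions of the travelling wave equation -/

section Rigidity

lemma lintegral_enorm_sq_ne_top {α E : Type*} [MeasurableSpace α] [NormedAddCommGroup E]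
    {μ : Measure α} {f : α → E} (hf : MemLp f 2 μ) : ∫⁻ x, ‖f x‖ₑ ^ 2 ∂μ ≠ ⊤ := by
  have := lintegral_rpow_enorm_lt_top_of_eLpNorm_lt_top two_ne_zero (by simp) hf.2
  simpa using this.ne

lemma exists_pos_le_abs_sub {r₀ l : ℝ} (hr₀ : 0 < r₀) (hl : 0 < l) :
    ∃ d > 0, ∀ x, 0 ≤ x → l ≤ |x ^ 2 - r₀ ^ 2| → d ≤ |x - r₀| := by
  -- If `|x - r₀| < 1` then `x + r₀ ≤ 2 r₀ + 1`, which controls the other factor of `x² - r₀²`.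
  refine ⟨min 1 (l / (2 * r₀ + 1)), by positivity, fun x hx hlx ↦ ?_⟩
  by_contra! h
  obtain ⟨h1, h2⟩ := lt_min_iff.1 h
  rw [lt_div_iff₀ (by positivity)] at h2
  rw [show x ^ 2 - r₀ ^ 2 = (x - r₀) * (x + r₀) by ring, abs_mul,
    abs_of_pos (by positivity : 0 < x + r₀)] at hlx
  have h3 : x + r₀ ≤ 2 * r₀ + 1 := by linarith [(abs_lt.1 h1).2]
  nlinarith [abs_nonneg (x - r₀)]

lemma ae_integrable_slice {n : ℕ} {E : Type*} [NormedAddCommGroup E] {f : Space (n + 1) → E}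
    (hf : Integrable f) (i : Fin (n + 1)) :
    ∀ᵐ y : Fin n → ℝ, Integrable fun s ↦ f (slicePoint i (s, y)) := by
  have h1 := (measurePreserving_slicePoint i).integrable_comp_emb
    (measurableEmbedding_slicePoint i) |>.2 hf
  exact h1.prod_left_ae

lemma slicePoint_single_right {m : ℕ} (h : ℝ) :
    slicePoint (n := m + 1) 0 (0, Pi.single 0 h) = h • EuclideanSpace.single 1 1 := by
  ext j
  refine Fin.succAboveCases 0 ?_ (fun k ↦ ?_) j
  · simp
  · rw [slicePoint_apply_succAbove]
    refine Fin.cases ?_ (fun k ↦ ?_) k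
    · simp
    · simp [Fin.ext_iff]

lemma aemeasurable_lintegral_slice {n : ℕ} {f : Space (n + 1) → ℝ≥0∞} (hf : AEMeasurable f)
    (i : Fin (n + 1)) : AEMeasurable fun y : Fin n → ℝ ↦ ∫⁻ s, f (slicePoint i (s, y)) :=
  AEMeasurable.lintegral_prod_left' (f := fun z ↦ f (slicePoint i z))
    (hf.comp_quasiMeasurePreserving (measurePreserving_slicePoint i).quasiMeasurePreserving)

variable {m : ℕ} {r₀ c : ℝ} {φ F : ℝ → ℝ} {v g g₁ : Space (m + 2) → ℂ}

lemma ae_isRegularSlice (hF : Continuous F) (hv : IsWeakPartial 0 v g) (hg : MemLp g 2)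
    (hq : MemLp (fun x ↦ φ ‖(r₀ : ℂ) - v x‖ ^ 2 - r₀ ^ 2) 2)
    (hEL : IsWeakPartial 0 g fun x ↦
      Complex.I * c * g x + F (‖(r₀ : ℂ) - v x‖ ^ 2) * (r₀ - v x)) :
    ∀ᵐ y : Fin (m + 1) → ℝ, IsRegularSlice r₀ φ F c (fun s ↦ v (slicePoint 0 (s, y)))
      fun s ↦ g (slicePoint 0 (s, y)) := by
  have h1 : Integrable fun x ↦ ‖g x‖ ^ 2 := by
    simpa using hg.integrable_norm_rpow two_ne_zero (by simp)
  filter_upwards [hv.ae_exists_ae_eq_primitive, hEL.ae_exists_ae_eq_primitive,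
    ae_locallyIntegrable_slice hEL.2.1 0, ae_integrable_slice h1 0,
    ae_integrable_slice hq.integrable_sq 0] with y ⟨k₀, hk₀⟩ ⟨k₁, hk₁⟩ h2 h3 h4
  exact isRegularSlice_of_ae_eq_primitive hF hk₀ h2 hk₁ h3 h4

/-- A finite energy solution of the one-dimensional travelling wave equation on almost every line
parallel to the first axis does not depend on the first variable, as soon as it has a square
integrable derivative in some other direction. -/
theorem ae_eq_zero_of_isWeakPartial (hφ : IsTruncation r₀ φ) (hr₀ : 0 < r₀) (hF : Continuous F)
    {l : ℝ} (hl0 : 0 < l) (hl : ∀ s, s ≠ r₀ ^ 2 → |s - r₀ ^ 2| < l →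
      c ^ 2 * (s - r₀ ^ 2) ^ 2 < 4 * s * potential r₀ F s)
    (hv : IsWeakPartial 0 v g) (hg : MemLp g 2) (hv₁ : IsWeakPartial 1 v g₁) (hg₁ : MemLp g₁ 2)
    (hq : MemLp (fun x ↦ φ ‖(r₀ : ℂ) - v x‖ ^ 2 - r₀ ^ 2) 2)
    (hEL : IsWeakPartial 0 g fun x ↦
      Complex.I * c * g x + F (‖(r₀ : ℂ) - v x‖ ^ 2) * (r₀ - v x)) :
    g =ᵐ[volume] 0 := by
  have hreg := ae_isRegularSlice hF hv hg hq hEL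
  have hgm : AEMeasurable fun x ↦ ‖g x‖ₑ ^ 2 := hg.1.enorm.pow_const 2
  -- The transverse positions of the lines along which `v` is not constant. Membership is read off
  -- `g` directly, which makes `A` measurable.
  set A : Set (Fin (m + 1) → ℝ) := {y | ∫⁻ s, ‖g (slicePoint 0 (s, y))‖ₑ ^ 2 ≠ 0} with hA
  have hAm : NullMeasurableSet A :=
    (aemeasurable_lintegral_slice hgm 0).nullMeasurable (measurableSet_singleton 0).compl
  have hAfin : volume A ≠ ⊤ := by
    have hem : AEMeasurable fun x ↦ ‖g x‖ₑ ^ 2 + ‖φ ‖(r₀ : ℂ) - v x‖ ^ 2 - r₀ ^ 2‖ₑ ^ 2 :=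
      hgm.add (hq.1.enorm.pow_const 2)
    set K : ℝ≥0∞ := ENNReal.ofReal ((1 + 1 / r₀ ^ 2) ^ 2 + 4 * (1 + r₀ ^ 2)) with hK
    -- Chebyshev: every line in `A` carries a fixed amount of the finite total energy.
    have h1 := mul_meas_ge_le_lintegral₀ ((aemeasurable_lintegral_slice hem 0).const_mul K)
      (ENNReal.ofReal (Real.arctan l ^ 2))
    rw [lintegral_const_mul' _ _ ENNReal.ofReal_ne_top, ← lintegral_slicePoint 0 hem,
      lintegral_add_left' hgm] at h1
    have h2 : volume A ≤ volume {y | ENNReal.ofReal (Real.arctan l ^ 2) ≤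
        K * ∫⁻ s, (‖g (slicePoint 0 (s, y))‖ₑ ^ 2 +
          ‖φ ‖(r₀ : ℂ) - v (slicePoint 0 (s, y))‖ ^ 2 - r₀ ^ 2‖ₑ ^ 2)} :=
      measure_mono_ae (hreg.mono fun y hy hyA ↦ hy.arctan_sq_le hφ hr₀ hF hl0.le hl hyA)
    have h3 : ENNReal.ofReal (Real.arctan l ^ 2) ≠ 0 := by
      have := Real.arctan_pos.2 hl0
      simpa using by positivity
    have h4 : K * ((∫⁻ x, ‖g x‖ₑ ^ 2) + ∫⁻ x, ‖φ ‖(r₀ : ℂ) - v x‖ ^ 2 - r₀ ^ 2‖ₑ ^ 2) ≠ ⊤ :=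
      ENNReal.mul_ne_top ENNReal.ofReal_ne_top (ENNReal.add_ne_top.2
        ⟨lintegral_enorm_sq_ne_top hg, lintegral_enorm_sq_ne_top hq⟩)
    intro h5
    rw [h5, top_le_iff] at h2
    rw [h2, ENNReal.mul_top h3, top_le_iff] at h1
    exact h4 h1
  obtain ⟨d, hd0, hd⟩ := exists_pos_le_abs_sub hr₀ hl0
  have hD : ENNReal.ofReal d ^ 2 ≠ 0 := by simpa using hd0
  set θ : ℝ → ℝ≥0∞ := fun h ↦
    ∫⁻ x, ‖g (x + h • EuclideanSpace.single 1 1) - g x‖ₑ ^ 2 with hθ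
  set K₁ : ℝ≥0∞ := ∫⁻ x, ‖g₁ x‖ₑ ^ 2 with hK₁
  -- A point which the translation moves across the boundary of `A` pairs a trivial slice with a
  -- nontrivial one, so Chebyshev applies to the distance of slices. The difference of `v` is of
  -- order `h` in `L²` by the transverse derivative; for `g` only continuity of translations in `L²`
  -- is available.
  have hbound : ∀ h ε : ℝ, 0 ≤ h → 0 < ε →
      ENNReal.ofReal d ^ 2 * volume {y | ¬(y ∈ A ↔ y + Pi.single 0 h ∈ A)} ≤
        ENNReal.ofReal ε⁻¹ * (ENNReal.ofReal h ^ 2 * K₁) + ENNReal.ofReal ε * θ h := by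
    intro h ε hh hε
    have hmp : MeasurePreserving (fun x : Space (m + 2) ↦ x + h • EuclideanSpace.single 1 1) :=
      measurePreserving_add_right volume _
    have hm1 : AEMeasurable fun x ↦ ‖v (x + h • EuclideanSpace.single 1 1) - v x‖ₑ ^ 2 :=
      ((hv.1.aestronglyMeasurable.comp_measurePreserving hmp).sub
        hv.1.aestronglyMeasurable).enorm.pow_const 2
    have hm2 : AEMeasurable fun x ↦ ‖g (x + h • EuclideanSpace.single 1 1) - g x‖ₑ ^ 2 :=
      ((hg.1.comp_measurePreserving hmp).sub hg.1).enorm.pow_const 2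
    have hs : ∀ (s : ℝ) (y : Fin (m + 1) → ℝ), slicePoint 0 (s, y + Pi.single 0 h) =
        slicePoint 0 (s, y) + h • EuclideanSpace.single 1 1 := fun s y ↦ by
      rw [← slicePoint_single_right, ← slicePoint_add, Prod.mk_add_mk, add_zero]
    have h1 := mul_meas_ge_le_lintegral₀
      (((aemeasurable_lintegral_slice hm1 0).const_mul (ENNReal.ofReal ε⁻¹)).add
      ((aemeasurable_lintegral_slice hm2 0).const_mul (ENNReal.ofReal ε))) (ENNReal.ofReal d ^ 2)
    simp only [Pi.add_apply] at h1
    rw [lintegral_add_left' ((aemeasurable_lintegral_slice hm1 0).const_mul _),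
      lintegral_const_mul' _ _ ENNReal.ofReal_ne_top, lintegral_const_mul' _ _ ENNReal.ofReal_ne_top,
      ← lintegral_slicePoint 0 hm1, ← lintegral_slicePoint 0 hm2] at h1
    have h2 := hv₁.lintegral_translate_sub_le hh
    refine le_trans ?_ (h1.trans (add_le_add_left (mul_le_mul_right h2 _) _))
    refine mul_le_mul_right (measure_mono_ae ?_) _
    filter_upwards [hreg, (measurePreserving_add_right volume
      (Pi.single 0 h : Fin (m + 1) → ℝ)).quasiMeasurePreserving.ae hreg] with y hy hy' hE
    simp only [← hs]
    change ENNReal.ofReal d ^ 2 ≤ _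
    by_cases hyA : y ∈ A
    · have hyA' : ¬ y + Pi.single 0 h ∈ A := fun h ↦ hE ⟨fun _ ↦ h, fun _ ↦ hyA⟩
      exact hy.le_lintegral hφ hr₀ hF hl hy' hyA (not_not.1 hyA') hε hd
    · have hyA' : y + Pi.single 0 h ∈ A := by_contra fun h ↦
        hE ⟨fun h' ↦ absurd h' hyA, fun h' ↦ absurd h' h⟩
      have := hy'.le_lintegral hφ hr₀ hF hl hy hyA' (not_not.1 hyA) hε hd
      simpa only [enorm_sub_rev] using this
  have hlim : ∀ M : ℝ, 0 < M → ENNReal.ofReal d ^ 2 *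
      volume {y | ¬(y ∈ A ↔ y + Pi.single 0 1 ∈ A)} ≤ ENNReal.ofReal M⁻¹ * K₁ := by
    intro M hM
    have hstep : ∀ n : ℕ, ENNReal.ofReal d ^ 2 * volume {y | ¬(y ∈ A ↔ y + Pi.single 0 1 ∈ A)} ≤
        ENNReal.ofReal M⁻¹ * K₁ + ENNReal.ofReal M * θ (1 / ((n : ℝ) + 1)) := by
      intro n
      have hn : (0 : ℝ) < n + 1 := by positivity
      have h1 := measure_translate_not_iff_le (A := A) (n + 1) (1 / ((n : ℝ) + 1))
      rw [Nat.cast_add_one, mul_one_div_cancel hn.ne'] at h1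
      -- With `n + 1` steps of length `1 / (n + 1)` and `ε = M / (n + 1)`, the powers of `n + 1`
      -- cancel in both terms, leaving `K₁ / M` and `M θ(1 / (n + 1))`. The latter tends to `0` for
      -- fixed `M`; afterwards `M → ∞`.
      have h2 := hbound (1 / ((n : ℝ) + 1)) (M / (n + 1)) (by positivity) (by positivity)
      have hcast : ((n + 1 : ℕ) : ℝ≥0∞) = ENNReal.ofReal ((n : ℝ) + 1) := by
        rw [← Nat.cast_add_one, ENNReal.ofReal_natCast]
      rw [hcast] at h1
      calc _ ≤ ENNReal.ofReal d ^ 2 * (ENNReal.ofReal ((n : ℝ) + 1) * _) := mul_le_mul_right h1 _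
        _ = ENNReal.ofReal ((n : ℝ) + 1) * (ENNReal.ofReal d ^ 2 * _) := by ring
        _ ≤ ENNReal.ofReal ((n : ℝ) + 1) * _ := mul_le_mul_right h2 _
        _ = _ := by
          rw [mul_add, ← mul_assoc, ← mul_assoc, ← mul_assoc, ← ENNReal.ofReal_pow (by positivity),
            ← ENNReal.ofReal_mul hn.le, ← ENNReal.ofReal_mul (by positivity),
            ← ENNReal.ofReal_mul hn.le]
          congr 3
          · field_simp
          · field_simp
    have hθ0 : Tendsto (fun n : ℕ ↦ θ (1 / ((n : ℝ) + 1))) atTop (𝓝 0) := by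
      refine (tendsto_lintegral_enorm_translate_sub hg).comp ?_
      have := (tendsto_one_div_add_atTop_nhds_zero_nat (𝕜 := ℝ)).smul_const
        (EuclideanSpace.single (1 : Fin (m + 2)) (1 : ℝ))
      rwa [zero_smul] at this
    have h3 := (ENNReal.Tendsto.const_mul hθ0 (Or.inr (ENNReal.ofReal_ne_top (r := M)))).const_add
      (ENNReal.ofReal M⁻¹ * K₁)
    rw [mul_zero, add_zero] at h3
    exact ge_of_tendsto' h3 hstep
  have hE0 : volume {y | ¬(y ∈ A ↔ y + Pi.single 0 1 ∈ A)} = 0 := by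
    have h1 : Tendsto (fun n : ℕ ↦ ENNReal.ofReal ((n : ℝ) + 1)⁻¹ * K₁) atTop (𝓝 0) := by
      have h2 := ENNReal.tendsto_ofReal (tendsto_one_div_add_atTop_nhds_zero_nat (𝕜 := ℝ))
      have h3 := ENNReal.Tendsto.mul_const h2 (Or.inr (lintegral_enorm_sq_ne_top hg₁))
      simpa only [one_div, ENNReal.ofReal_zero, zero_mul] using h3
    have h4 := ge_of_tendsto' h1 fun n ↦ hlim ((n : ℝ) + 1) (by positivity)
    exact (mul_eq_zero.1 (le_zero_iff.1 h4)).resolve_left hD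
  have hA0 := measure_eq_zero_of_ae_translate_iff hAm hAfin hE0
  have h0 : ∫⁻ x, ‖g x‖ₑ ^ 2 = 0 := by
    rw [lintegral_slicePoint 0 hgm, lintegral_congr_ae (g := fun _ ↦ 0) ?_, lintegral_zero]
    exact (measure_eq_zero_iff_ae_notMem.1 hA0).mono fun y hy ↦ not_not.1 hy
  rw [lintegral_eq_zero_iff' hgm] at h0
  exact h0.mono fun x hx ↦ by simpa using hx


end Rigidity

/-! ### Calculus of weak partial derivatives -/

section WeakPartial

variable {N : ℕ} {G : Type*} [NormedAddCommGroup G] [NormedSpace ℝ G] {i : Fin N}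
  {u u₁ g g₁ : Space N → G}

lemma continuous_fderiv_single {ψ : Space N → G} (hψ : ContDiff ℝ ∞ ψ) :
    Continuous fun x ↦ fderiv ℝ ψ x (EuclideanSpace.single i 1) :=
  (hψ.continuous_fderiv (by simp)).clm_apply continuous_const

lemma hasCompactSupport_fderiv_single {ψ : Space N → G} (hψ : HasCompactSupport ψ) :
    HasCompactSupport fun x ↦ fderiv ℝ ψ x (EuclideanSpace.single i 1) :=
  hψ.fderiv_apply ℝ _

lemma IsWeakPartial.ae_eq [CompleteSpace G] (h : IsWeakPartial i u g) (h₁ : IsWeakPartial i u g₁) :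
    g =ᵐ[volume] g₁ :=
  ae_eq_of_integral_contDiff_smul_eq h.2.1 h₁.2.1 fun ψ hψ hψc ↦ by
    have := h.2.2 ψ hψ hψc
    rw [h₁.2.2 ψ hψ hψc] at this
    exact (neg_injective this).symm

lemma IsWeakPartial.isWeakPartial_weakPartial (h : IsWeakPartial i u g) :
    IsWeakPartial i u (weakPartial i u) := by
  have hex : ∃ g, IsWeakPartial i u g := ⟨g, h⟩
  rw [weakPartial, dif_pos hex]
  exact hex.choose_spec

lemma IsWeakPartial.weakPartial_ae_eq [CompleteSpace G] (h : IsWeakPartial i u g) :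
    weakPartial i u =ᵐ[volume] g :=
  h.isWeakPartial_weakPartial.ae_eq h

lemma IsWeakPartial.congr_right (h : IsWeakPartial i u g) (hg : g =ᵐ[volume] g₁) :
    IsWeakPartial i u g₁ :=
  ⟨h.1, h.2.1.congr hg, fun ψ hψ hψc ↦ by
    rw [h.2.2 ψ hψ hψc]
    exact congrArg _ (integral_congr_ae (hg.mono fun x hx ↦ by simp only [hx]))⟩

lemma IsWeakPartial.add (h : IsWeakPartial i u g) (h₁ : IsWeakPartial i u₁ g₁) :
    IsWeakPartial i (u + u₁) (g + g₁) := by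
  refine ⟨h.1.add h₁.1, h.2.1.add h₁.2.1, fun ψ hψ hψc ↦ ?_⟩
  have hd := continuous_fderiv_single (i := i) hψ
  have hdc := hasCompactSupport_fderiv_single (i := i) hψc
  simp only [Pi.add_apply, smul_add]
  rw [integral_add (h.1.integrable_smul_left_of_hasCompactSupport hd hdc)
    (h₁.1.integrable_smul_left_of_hasCompactSupport hd hdc),
    integral_add (h.2.1.integrable_smul_left_of_hasCompactSupport hψ.continuous hψc)
    (h₁.2.1.integrable_smul_left_of_hasCompactSupport hψ.continuous hψc), h.2.2 ψ hψ hψc,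
    h₁.2.2 ψ hψ hψc, neg_add]

lemma IsWeakPartial.const_smul (h : IsWeakPartial i u g) (t : ℝ) :
    IsWeakPartial i (t • u) (t • g) := by
  refine ⟨h.1.smul t, h.2.1.smul t, fun ψ hψ hψc ↦ ?_⟩
  simp only [Pi.smul_apply, smul_comm _ t]
  rw [integral_smul, integral_smul, h.2.2 ψ hψ hψc, smul_neg]

/-- A smooth function is weakly differentiable. -/
lemma isWeakPartial_fderiv [CompleteSpace G] {w : Space N → G} (hw : ContDiff ℝ ∞ w) :
    IsWeakPartial i w fun x ↦ fderiv ℝ w x (EuclideanSpace.single i 1) := by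
  have hwl : LocallyIntegrable w := hw.continuous.locallyIntegrable
  have hdl : LocallyIntegrable fun x ↦ fderiv ℝ w x (EuclideanSpace.single i 1) :=
    (continuous_fderiv_single hw).locallyIntegrable
  refine ⟨hwl, hdl, fun ψ hψ hψc ↦ ?_⟩
  rw [integral_smul_fderiv_eq_neg_fderiv_smul_of_integrable, neg_neg]
  · exact hwl.integrable_smul_left_of_hasCompactSupport (continuous_fderiv_single hψ)
      (hasCompactSupport_fderiv_single hψc)
  · exact hdl.integrable_smul_left_of_hasCompactSupport hψ.continuous hψc
  · exact hwl.integrable_smul_left_of_hasCompactSupport hψ.continuous hψc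
  · exact fun x _ ↦ hψ.differentiable (by simp) x
  · exact fun x _ ↦ hw.differentiable (by simp) x

lemma MemD12.add (h : MemD12 u) (h₁ : MemD12 u₁) : MemD12 (u + u₁) := by
  refine ⟨h.1.add h₁.1, fun i ↦ ?_⟩
  obtain ⟨g, hg, hg2⟩ := h.2 i
  obtain ⟨g₁, hg₁, hg₁2⟩ := h₁.2 i
  exact ⟨g + g₁, hg.add hg₁, hg2.add hg₁2⟩

lemma MemD12.const_smul (h : MemD12 u) (t : ℝ) : MemD12 (t • u) := by
  refine ⟨h.1.const_smul t, fun i ↦ ?_⟩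
  obtain ⟨g, hg, hg2⟩ := h.2 i
  exact ⟨t • g, hg.const_smul t, hg2.const_smul t⟩

lemma MemD12.isWeakPartial_weakPartial (h : MemD12 u) (i : Fin N) :
    IsWeakPartial i u (weakPartial i u) :=
  let ⟨_, hg, _⟩ := h.2 i
  hg.isWeakPartial_weakPartial

lemma MemD12.memLp_weakPartial [CompleteSpace G] (h : MemD12 u) (i : Fin N) :
    MemLp (weakPartial i u) 2 volume :=
  let ⟨_, hg, hg2⟩ := h.2 i
  hg2.ae_eq hg.weakPartial_ae_eq.symm

end WeakPartial

/-! ### The extended integral -/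

section ExtendedIntegral

lemma two_lt_sobolev {N : ℕ} (hN : 3 ≤ N) : 2 < 2 * (N : ℝ) / ((N : ℝ) - 2) := by
  have : (3 : ℝ) ≤ N := by exact_mod_cast hN
  rw [lt_div_iff₀ (by linarith)]
  linarith

lemma integrable_norm_rpow_sobolev {N : ℕ} (hN : 3 ≤ N) {α G : Type*} [MeasurableSpace α]
    {μ : Measure α} [NormedAddCommGroup G] {u : α → G} (hu : MemLp u (sobolevExponent N) μ) :
    Integrable (fun x ↦ ‖u x‖ ^ (2 * (N : ℝ) / ((N : ℝ) - 2))) μ := by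
  have h2 := two_lt_sobolev hN
  have h := hu.integrable_norm_rpow (by
    rw [sobolevExponent, Ne, ENNReal.ofReal_eq_zero, not_le]; linarith) (by simp [sobolevExponent])
  rwa [sobolevExponent, ENNReal.toReal_ofReal (by linarith)] at h

/-- If a power of a primitive of an integrable function is integrable, the function has integral
zero. -/
lemma integral_eq_zero_of_integrable_rpow_primitive {f : ℝ → ℝ} (hf : Integrable f) {k p : ℝ}
    (hp : 0 < p) (hk : Integrable fun s ↦ ‖k + ∫ t in (0 : ℝ)..s, f t‖ ^ p) : ∫ s, f s = 0 := by
  have aux : ∀ x : ℕ → ℝ, Tendsto ((fun s ↦ ‖k + ∫ t in (0 : ℝ)..s, f t‖ ^ p) ∘ x) atTop (𝓝 0) →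
      Tendsto (fun n ↦ k + ∫ t in (0 : ℝ)..(x n), f t) atTop (𝓝 0) := by
    intro x hx
    have h1 := hx.rpow_const (p := p⁻¹) (Or.inr (by positivity))
    rw [Real.zero_rpow (by positivity)] at h1
    rw [tendsto_zero_iff_norm_tendsto_zero]
    refine h1.congr fun n ↦ ?_
    simp only [Function.comp]
    rw [Real.rpow_rpow_inv (norm_nonneg _) hp.ne']
  obtain ⟨x, hx1, hx2⟩ := exists_seq_tendsto_zero_atTop hk fun s ↦ by positivity
  obtain ⟨y, hy1, hy2⟩ := exists_seq_tendsto_zero_atBot hk fun s ↦ by positivity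
  have h1 := tendsto_nhds_unique (aux x hx2)
    ((intervalIntegral_tendsto_integral_Ioi 0 hf.integrableOn hx1).const_add k)
  have h2 := tendsto_nhds_unique (aux y hy2)
    (((intervalIntegral_tendsto_integral_Iic 0 hf.integrableOn hy1).neg.const_add k).congr
      fun n ↦ by rw [← intervalIntegral.integral_symm])
  rw [← intervalIntegral.integral_Iic_add_Ioi hf.integrableOn hf.integrableOn (b := 0)]
  linarith

variable {N : ℕ} [NeZero N]

/-- A function of `L¹ ∩ 𝒴` has integral zero. -/
lemma integral_eq_zero_of_isWeakPartial (hN : 3 ≤ N) {f χ : Space N → ℝ} (hf : Integrable f)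
    (hχ : MemD12 χ) (hfχ : IsWeakPartial 0 χ f) : ∫ x, f x = 0 := by
  have hχp := integrable_norm_rpow_sobolev hN hχ.1
  have hp := two_lt_sobolev hN
  set p : ℝ := 2 * (N : ℝ) / ((N : ℝ) - 2)
  obtain ⟨n, rfl⟩ : ∃ n, N = n + 1 := ⟨N - 1, by omega⟩
  -- On almost every line `χ` is a primitive of `f` with an integrable power, so both of its limits
  -- at infinity vanish.
  have h1 : ∀ᵐ y : Fin n → ℝ, ∫ s, f (slicePoint 0 (s, y)) = 0 := by
    filter_upwards [hfχ.ae_exists_ae_eq_primitive, ae_integrable_slice hf 0,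
      ae_integrable_slice hχp 0] with y ⟨k, hk⟩ h2 h3
    refine integral_eq_zero_of_integrable_rpow_primitive h2 (by linarith : 0 < p) (k := k)
      (h3.congr (hk.mono fun s hs ↦ ?_))
    simp only [hs]
  have hfi := (measurePreserving_slicePoint 0).integrable_comp_emb
    (measurableEmbedding_slicePoint (n := n) 0) |>.2 hf
  rw [← (measurePreserving_slicePoint 0).integral_comp (measurableEmbedding_slicePoint (n := n) 0),
    integral_prod_symm (fun z ↦ f (slicePoint 0 z)) hfi, integral_congr_ae h1, integral_zero]

/-- Membership in `L¹ + 𝒴`. -/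
def IsDecomposable (h : Space N → ℝ) : Prop :=
  ∃ f : Space N → ℝ, Integrable f volume ∧
    ∃ χ : Space N → ℝ, MemD12 χ ∧ h =ᵐ[volume] f + weakPartial 0 χ

/-- Two decompositions differ by a function of `L¹ ∩ 𝒴`, which has integral zero; so the one picked
by choice is as good as any other. -/
lemma extendedIntegral_eq (hN : 3 ≤ N) {h f χ : Space N → ℝ} (hf : Integrable f) (hχ : MemD12 χ)
    (hh : h =ᵐ[volume] f + weakPartial 0 χ) : extendedIntegral h = ∫ x, f x := by
  have H : ∃ f : Space N → ℝ, Integrable f volume ∧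
    ∃ χ : Space N → ℝ, MemD12 χ ∧ h =ᵐ[volume] f + weakPartial 0 χ := ⟨f, hf, χ, hχ, hh⟩
  rw [extendedIntegral, dif_pos H]
  obtain ⟨hf', χ', hχ', hh'⟩ := H.choose_spec
  have hd : MemD12 (χ + (-1 : ℝ) • χ') := hχ.add (hχ'.const_smul _)
  have hw : IsWeakPartial 0 (χ + (-1 : ℝ) • χ') (H.choose - f) := by
    refine ((hχ.isWeakPartial_weakPartial 0).add
      ((hχ'.isWeakPartial_weakPartial 0).const_smul (-1))).congr_right ?_
    filter_upwards [hh, hh'] with x h1 h2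
    simp only [Pi.add_apply, Pi.smul_apply, Pi.sub_apply, smul_eq_mul] at h1 h2 ⊢
    linarith
  have h0 := integral_eq_zero_of_isWeakPartial hN (hf'.sub hf) hd hw
  rw [integral_sub' hf' hf] at h0
  linarith

lemma IsDecomposable.extendedIntegral_add (hN : 3 ≤ N) {h k h' : Space N → ℝ}
    (hh : IsDecomposable h) (hk : Integrable k) (hh' : h' =ᵐ[volume] h + k) :
    extendedIntegral h' = extendedIntegral h + ∫ x, k x := by
  obtain ⟨f, hf, χ, hχ, hfχ⟩ := hh
  rw [extendedIntegral_eq hN hf hχ hfχ, extendedIntegral_eq hN (hf.add hk) hχ, integral_add' hf hk]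
  filter_upwards [hfχ, hh'] with x h1 h2
  simp only [Pi.add_apply] at h1 h2 ⊢
  rw [h2, h1]
  ring

/-- Adding an integrable function does not affect membership in `L¹ + 𝒴`, so the default value
persists. -/
lemma extendedIntegral_eq_zero_of_not {h k h' : Space N → ℝ} (hh : ¬IsDecomposable h)
    (hk : Integrable k) (hh' : h' =ᵐ[volume] h + k) : extendedIntegral h' = 0 := by
  rw [extendedIntegral, dif_neg]
  rintro ⟨f, hf, χ, hχ, hfχ⟩
  refine hh ⟨f - k, hf.sub hk, χ, hχ, ?_⟩
  filter_upwards [hfχ, hh'] with x h1 h2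
  simp only [Pi.add_apply, Pi.sub_apply] at h1 h2 ⊢
  linarith

end ExtendedIntegral

/-! ### Growth of the nonlinearity -/

section Growth

variable {N : ℕ} {r₀ : ℝ} {F φ : ℝ → ℝ}

/-- Continuity handles `[0, 1]`; beyond `1` the power increases with the exponent. The critical
exponent suffices for all that follows. -/
lemma exists_abs_le_of_assumptionA2 (hF : ContinuousOn F (Set.Ici 0))
    (hA2 : AssumptionA2 N F) :
    ∃ C > 0, ∀ s, 0 ≤ s → |F s| ≤ C * (1 + s ^ (2 / ((N : ℝ) - 2))) := by
  obtain ⟨C, p₀, hC, hp₀, hb⟩ := hA2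
  obtain ⟨M, hM⟩ := (isCompact_Icc (a := (0 : ℝ)) (b := 1)).exists_bound_of_continuousOn
    (hF.mono Set.Icc_subset_Ici_self)
  refine ⟨max C M, lt_max_of_lt_left hC, fun s hs ↦ ?_⟩
  have hs' : 0 ≤ s ^ (2 / ((N : ℝ) - 2)) := Real.rpow_nonneg hs _
  have hm : 0 ≤ max C M := (lt_max_of_lt_left hC).le
  rcases le_total s 1 with h | h
  · calc |F s| ≤ M := hM s ⟨hs, h⟩
      _ ≤ max C M := le_max_right _ _
      _ ≤ _ := le_mul_of_one_le_right hm (by linarith)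
  · calc |F s| ≤ C * (1 + s ^ p₀) := hb s hs
      _ ≤ max C M * (1 + s ^ (2 / ((N : ℝ) - 2))) := by
        have := Real.rpow_nonneg hs p₀
        gcongr
        exact le_max_left _ _

lemma two_mul_rpow_add_two (hN : 3 ≤ N) {a : ℝ} (ha : 0 ≤ a) :
    (a ^ 2) ^ (2 / ((N : ℝ) - 2)) * a ^ 2 = a ^ (2 * (N : ℝ) / ((N : ℝ) - 2)) := by
  have hN' : (3 : ℝ) ≤ N := by exact_mod_cast hN
  have h : (N : ℝ) - 2 ≠ 0 := by linarith
  have hσ : 0 ≤ 2 / ((N : ℝ) - 2) := div_nonneg (by norm_num) (by linarith)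
  rw [← Real.rpow_natCast, ← Real.rpow_mul ha, ← Real.rpow_add' ha]
  · congr 1
    push_cast
    field_simp
    ring
  · push_cast
    positivity

/-- The force `F(|u|²) u` grows at most like `|u|^{2^*}`, so it is locally integrable and can be
dominated when differentiating the potential term. -/
lemma exists_abs_mul_le (hN : 3 ≤ N) {C : ℝ} (hC : 0 < C)
    (hF : ∀ s, 0 ≤ s → |F s| ≤ C * (1 + s ^ (2 / ((N : ℝ) - 2)))) {a : ℝ} (ha : 0 ≤ a) :
    |F (a ^ 2)| * a ≤ 2 * C * (1 + a ^ (2 * (N : ℝ) / ((N : ℝ) - 2))) := by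
  have hN' : (3 : ℝ) ≤ N := by exact_mod_cast hN
  have hσ : 0 ≤ 2 / ((N : ℝ) - 2) := div_nonneg (by norm_num) (by linarith)
  have h1 := hF (a ^ 2) (by positivity)
  have h2 := two_mul_rpow_add_two hN ha
  set q := (a ^ 2) ^ (2 / ((N : ℝ) - 2))
  have hq : 0 ≤ q := by positivity
  have h3 : (1 + q) * a ≤ 2 * (1 + q * a ^ 2) := by
    rcases le_total a 1 with h | h
    · have hq1 : q ≤ 1 := Real.rpow_le_one (by positivity) (by nlinarith) hσ
      nlinarith [mul_nonneg hq (sq_nonneg a), mul_nonneg hq ha]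
    · have hq1 : 1 ≤ q := Real.one_le_rpow (by nlinarith) hσ
      nlinarith [mul_nonneg hq (sq_nonneg a), mul_nonneg hq ha, mul_le_mul_of_nonneg_left h hq,
        mul_nonneg (mul_nonneg hq ha) (sub_nonneg.2 h)]
  rw [← h2]
  calc |F (a ^ 2)| * a ≤ C * (1 + q) * a := by gcongr
    _ = C * ((1 + q) * a) := by ring
    _ ≤ C * (2 * (1 + q * a ^ 2)) := by gcongr
    _ = _ := by ring

/-- The difference quotient at `a` extends continuously across `a`, hence is bounded on compact
sets. -/
lemma exists_abs_le_mul_abs_sub {F' a : ℝ} (hF : Continuous F) (hF0 : F a = 0)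
    (hF' : HasDerivAt F F' a) (b : ℝ) :
    ∃ C, 0 ≤ C ∧ ∀ τ ∈ Set.Icc 0 b, |F τ| ≤ C * |τ - a| := by
  have hc : ContinuousOn (dslope F a) Set.univ :=
    (continuousOn_dslope univ_mem).2 ⟨hF.continuousOn, hF'.differentiableAt⟩
  obtain ⟨M, hM⟩ := (isCompact_Icc (a := (0 : ℝ)) (b := b)).exists_bound_of_continuousOn
    (hc.mono (Set.subset_univ _))
  refine ⟨max M 0, le_max_right _ _, fun τ hτ ↦ ?_⟩
  have h1 := sub_smul_dslope F a τ
  rw [hF0, sub_zero, smul_eq_mul] at h1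
  rw [← h1, abs_mul, mul_comm]
  gcongr
  exact (hM τ hτ).trans (le_max_left _ _)

/-- The potential is controlled by the two terms which are integrable for functions of the energy
space. -/
lemma exists_abs_potential_le (hN : 3 ≤ N) (hr₀ : 0 < r₀) (hφ : IsTruncation r₀ φ)
    (hF : Continuous F) (hF0 : F (r₀ ^ 2) = 0) {F' : ℝ} (hF' : HasDerivAt F F' (r₀ ^ 2)) {C : ℝ}
    (hC : 0 < C) (hFC : ∀ s, 0 ≤ s → |F s| ≤ C * (1 + s ^ (2 / ((N : ℝ) - 2)))) :
    ∃ K, ∀ z : ℂ, |potential r₀ F (‖(r₀ : ℂ) - z‖ ^ 2)| ≤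
      K * ((φ ‖(r₀ : ℂ) - z‖ ^ 2 - r₀ ^ 2) ^ 2 + ‖z‖ ^ (2 * (N : ℝ) / ((N : ℝ) - 2))) := by
  have hN' : (3 : ℝ) ≤ N := by exact_mod_cast hN
  have hσ : 0 ≤ 2 / ((N : ℝ) - 2) := div_nonneg (by norm_num) (by linarith)
  have hp : 0 ≤ 2 * (N : ℝ) / ((N : ℝ) - 2) := by linarith [two_lt_sobolev hN]
  obtain ⟨C₀, hC₀, hlin⟩ := exists_abs_le_mul_abs_sub hF hF0 hF' (4 * r₀ ^ 2)
  set σ := 2 / ((N : ℝ) - 2) with hσdef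
  set p := 2 * (N : ℝ) / ((N : ℝ) - 2) with hpdef
  set L := (1 + ((r₀ ^ 2) ^ σ)⁻¹) with hL
  refine ⟨C₀ + C * L * 2 ^ p, fun z ↦ ?_⟩
  set ρ := ‖(r₀ : ℂ) - z‖ with hρ
  have hρ0 : 0 ≤ ρ := norm_nonneg _
  have hL0 : 0 ≤ C * L * 2 ^ p := by positivity
  have hz : 0 ≤ ‖z‖ ^ p := by positivity
  -- For `ρ ≤ 2 r₀` the potential is quadratic in `ρ² - r₀²` and the truncation is inactive. For `ρ
  -- ≥ 2 r₀` one has `ρ ≤ 2 ‖z‖`, and critical growth gives the power of `‖z‖`.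
  rcases le_total ρ (2 * r₀) with h | h
  · have h1 : ‖∫ τ in (ρ ^ 2)..(r₀ ^ 2), F τ‖ ≤ C₀ * |ρ ^ 2 - r₀ ^ 2| * |r₀ ^ 2 - ρ ^ 2| := by
      refine intervalIntegral.norm_integral_le_of_norm_le_const fun τ hτ ↦ ?_
      rw [Set.uIoc, Set.mem_Ioc] at hτ
      have h2 := lt_of_le_of_lt (le_min (by positivity) (by positivity)) hτ.1
      have h3 : τ ≤ 4 * r₀ ^ 2 := hτ.2.trans (max_le (by nlinarith) (by nlinarith))
      refine (hlin τ ⟨h2.le, h3⟩).trans ?_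
      refine mul_le_mul_of_nonneg_left ?_ hC₀
      rcases le_total (ρ ^ 2) (r₀ ^ 2) with h4 | h4
      · rw [min_eq_left h4, max_eq_right h4] at hτ
        rw [abs_of_nonpos (by linarith), abs_of_nonpos (by linarith)]
        linarith
      · rw [min_eq_right h4, max_eq_left h4] at hτ
        rw [abs_of_nonneg (by linarith), abs_of_nonneg (by linarith)]
        linarith
    rw [Real.norm_eq_abs, abs_sub_comm (r₀ ^ 2), mul_assoc, ← sq, sq_abs] at h1
    rw [hφ.eq_self ρ hρ0 h]
    refine h1.trans ?_
    have := mul_nonneg hL0 (sq_nonneg (ρ ^ 2 - r₀ ^ 2))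
    have := mul_nonneg hL0 hz
    have := mul_nonneg hC₀ hz
    linarith
  · have hr2 : r₀ ^ 2 ≤ ρ ^ 2 := by nlinarith
    have h1 : ‖∫ τ in (ρ ^ 2)..(r₀ ^ 2), F τ‖ ≤ C * (1 + (ρ ^ 2) ^ σ) * |r₀ ^ 2 - ρ ^ 2| := by
      refine intervalIntegral.norm_integral_le_of_norm_le_const fun τ hτ ↦ ?_
      rw [Set.uIoc, Set.mem_Ioc, min_eq_right hr2, max_eq_left hr2] at hτ
      have hτ0 : 0 ≤ τ := (sq_nonneg r₀).trans hτ.1.le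
      refine (hFC τ hτ0).trans ?_
      gcongr
      exact hτ.2
    have h2 : |r₀ ^ 2 - ρ ^ 2| ≤ ρ ^ 2 := by
      rw [abs_of_nonpos (by linarith)]
      nlinarith
    have h3 : 1 + (ρ ^ 2) ^ σ ≤ L * (ρ ^ 2) ^ σ := by
      have h4 : (r₀ ^ 2) ^ σ ≤ (ρ ^ 2) ^ σ := by gcongr
      have h5 : 0 < (r₀ ^ 2) ^ σ := by positivity
      have h6 : 1 ≤ ((r₀ ^ 2) ^ σ)⁻¹ * (ρ ^ 2) ^ σ := by
        rw [inv_mul_eq_div]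
        exact (one_le_div h5).2 h4
      rw [hL, add_mul, one_mul]
      linarith
    have h4 : ρ ≤ 2 * ‖z‖ := by
      have := norm_sub_norm_le (r₀ : ℂ) z
      have h5 : ρ ≤ r₀ + ‖z‖ := by
        refine (norm_sub_le _ _).trans_eq ?_
        rw [Complex.norm_real, Real.norm_of_nonneg hr₀.le]
      linarith
    calc |potential r₀ F (ρ ^ 2)| ≤ C * (1 + (ρ ^ 2) ^ σ) * |r₀ ^ 2 - ρ ^ 2| := h1
      _ ≤ C * (L * (ρ ^ 2) ^ σ) * ρ ^ 2 := by gcongr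
      _ = C * L * ((ρ ^ 2) ^ σ * ρ ^ 2) := by ring
      _ = C * L * ρ ^ p := by rw [two_mul_rpow_add_two hN hρ0]
      _ ≤ C * L * (2 * ‖z‖) ^ p := by gcongr
      _ = C * L * 2 ^ p * ‖z‖ ^ p := by rw [Real.mul_rpow (by norm_num) (norm_nonneg _)]; ring
      _ ≤ _ := by
        have := mul_nonneg hL0 (sq_nonneg (φ ρ ^ 2 - r₀ ^ 2))
        have := mul_nonneg hC₀ hz
        have := mul_nonneg hC₀ (sq_nonneg (φ ρ ^ 2 - r₀ ^ 2))
        linarith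

end Growth

/-! ### The Euler-Lagrange equation -/

section EulerLagrange

variable {N : ℕ} {r₀ p K : ℝ} {F : ℝ → ℝ} {v w : Space N → ℂ}

lemma norm_sub_rpow_le (hp : 0 ≤ p) {D : ℝ} (hD : 0 ≤ D) {a b : ℝ} (ha : 0 ≤ a) (hb : 0 ≤ b)
    (h : a ≤ b + D) : a ^ p ≤ 2 ^ p * (b ^ p + D ^ p) := by
  have h1 : a ≤ 2 * max b D := by
    rcases le_total b D with h' | h'
    · rw [max_eq_right h']; linarith
    · rw [max_eq_left h']; linarith
  calc a ^ p ≤ (2 * max b D) ^ p := by gcongr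
    _ = 2 ^ p * max b D ^ p := Real.mul_rpow (by norm_num) (by positivity)
    _ ≤ 2 ^ p * (b ^ p + D ^ p) := by
      have := Real.rpow_nonneg hb p
      have := Real.rpow_nonneg hD p
      gcongr
      rcases le_total b D with h' | h'
      · rw [max_eq_right h']; linarith
      · rw [max_eq_left h']; linarith

lemma norm_ofReal_sub_le (hr₀ : 0 ≤ r₀) (z : ℂ) : ‖(r₀ : ℂ) - z‖ ≤ ‖z‖ + r₀ := by
  refine (norm_sub_le _ _).trans_eq ?_
  rw [Complex.norm_real, Real.norm_of_nonneg hr₀, add_comm]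

lemma locallyIntegrable_nonlinearity (hr₀ : 0 ≤ r₀) (hp : 0 ≤ p) (hK : 0 ≤ K) (hF : Continuous F)
    (hFK : ∀ a, 0 ≤ a → |F (a ^ 2)| * a ≤ K * (1 + a ^ p)) (hvm : AEStronglyMeasurable v)
    (hv : Integrable fun x ↦ ‖v x‖ ^ p) :
    LocallyIntegrable fun x ↦ (F (‖(r₀ : ℂ) - v x‖ ^ 2) : ℂ) * (r₀ - v x) := by
  have hb : LocallyIntegrable fun x ↦ K * (1 + 2 ^ p * (‖v x‖ ^ p + r₀ ^ p)) :=
    ((locallyIntegrable_const (1 : ℝ)).add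
      ((hv.locallyIntegrable.add (locallyIntegrable_const (r₀ ^ p))).smul ((2 : ℝ) ^ p))).smul K
  have hum : AEStronglyMeasurable fun x ↦ (r₀ : ℂ) - v x := aestronglyMeasurable_const.sub hvm
  refine hb.mono ?_ (ae_of_all _ fun x ↦ ?_)
  · exact (Complex.continuous_ofReal.comp_aestronglyMeasurable
      (hF.comp_aestronglyMeasurable (hum.norm.pow 2))).mul hum
  · rw [norm_mul, Complex.norm_real, Real.norm_eq_abs]
    refine (hFK _ (norm_nonneg _)).trans (le_trans ?_ (Real.le_norm_self _))
    gcongr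
    exact norm_sub_rpow_le hp hr₀ (norm_nonneg _) (norm_nonneg _) (norm_ofReal_sub_le hr₀ _)

lemma hasDerivAt_integral_potential (hr₀ : 0 ≤ r₀) (hp : 0 ≤ p) (hK : 0 ≤ K) (hF : Continuous F)
    (hFK : ∀ a, 0 ≤ a → |F (a ^ 2)| * a ≤ K * (1 + a ^ p)) (hvm : AEStronglyMeasurable v)
    (hv : Integrable fun x ↦ ‖v x‖ ^ p)
    (hV : Integrable fun x ↦ potential r₀ F (‖(r₀ : ℂ) - v x‖ ^ 2))
    (hw : Continuous w) (hwc : HasCompactSupport w) :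
    HasDerivAt (fun t : ℝ ↦ ∫ x, potential r₀ F (‖(r₀ : ℂ) - (v x + t • w x)‖ ^ 2))
      (∫ x, 2 * (F (‖(r₀ : ℂ) - v x‖ ^ 2) * inner ℝ ((r₀ : ℂ) - v x) (w x))) 0 := by
  obtain ⟨W, hW⟩ := hwc.exists_bound_of_continuous hw
  have hW0 : 0 ≤ W := (norm_nonneg _).trans (hW 0)
  set D := r₀ + W with hD
  have hum : ∀ t : ℝ, AEStronglyMeasurable fun x ↦ (r₀ : ℂ) - (v x + t • w x) := fun t ↦
    aestronglyMeasurable_const.sub (hvm.add (hw.aestronglyMeasurable.const_smul t))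
  have hwi : Integrable fun x ↦ ‖w x‖ := (hw.integrable_of_hasCompactSupport hwc).norm
  have hvw : Integrable fun x ↦ ‖v x‖ ^ p * ‖w x‖ := by
    refine (hv.const_mul W).mono' (hv.1.mul hwi.1) (ae_of_all _ fun x ↦ ?_)
    rw [Real.norm_of_nonneg (by positivity), mul_comm]
    gcongr
    exact hW x
  -- The dominating function for `|t| < 1`; the factor `‖w x‖` makes the constant term integrable.
  have hb : Integrable fun x ↦ 2 * K * ((1 + 2 ^ p * D ^ p) * ‖w x‖ + 2 ^ p * (‖v x‖ ^ p * ‖w x‖)) :=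
    ((hwi.const_mul _).add (hvw.const_mul _)).const_mul _
  have hF'm : AEStronglyMeasurable fun x ↦
      2 * (F (‖(r₀ : ℂ) - (v x + (0 : ℝ) • w x)‖ ^ 2) *
        inner ℝ ((r₀ : ℂ) - (v x + (0 : ℝ) • w x)) (w x)) :=
    ((hF.comp_aestronglyMeasurable ((hum 0).norm.pow 2)).mul
      ((hum 0).inner hw.aestronglyMeasurable)).const_mul 2
  have key := hasDerivAt_integral_of_dominated_loc_of_deriv_le (μ := volume) (x₀ := (0 : ℝ))
    (Metric.ball_mem_nhds (0 : ℝ) one_pos)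
    (F := fun t x ↦ potential r₀ F (‖(r₀ : ℂ) - (v x + t • w x)‖ ^ 2))
    (F' := fun t x ↦ 2 * (F (‖(r₀ : ℂ) - (v x + t • w x)‖ ^ 2) *
      inner ℝ ((r₀ : ℂ) - (v x + t • w x)) (w x)))
    (Eventually.of_forall fun t ↦
      (continuous_potential hF).comp_aestronglyMeasurable ((hum t).norm.pow 2))
    (by simpa using hV) hF'm (ae_of_all _ fun x t ht ↦ ?_) hb (ae_of_all _ fun x t _ ↦ ?_)
  · simpa using key.2
  · rw [mem_ball_zero_iff, Real.norm_eq_abs] at ht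
    set a := ‖(r₀ : ℂ) - (v x + t • w x)‖ with ha
    have ha1 : a ≤ ‖v x‖ + D := by
      refine (norm_ofReal_sub_le hr₀ _).trans ?_
      have h1 : ‖v x + t • w x‖ ≤ ‖v x‖ + W := by
        refine (norm_add_le _ _).trans ?_
        rw [norm_smul, Real.norm_eq_abs]
        gcongr
        exact (mul_le_of_le_one_left (norm_nonneg _) ht.le).trans (hW x)
      linarith
    have ha2 := norm_sub_rpow_le hp (by positivity : 0 ≤ D) (norm_nonneg _) (norm_nonneg _) ha1
    calc ‖2 * (F (a ^ 2) * inner ℝ ((r₀ : ℂ) - (v x + t • w x)) (w x))‖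
        = 2 * (|F (a ^ 2)| * |inner ℝ ((r₀ : ℂ) - (v x + t • w x)) (w x)|) := by
          rw [norm_mul, norm_mul]; simp
      _ ≤ 2 * (|F (a ^ 2)| * (a * ‖w x‖)) := by
          gcongr
          exact abs_real_inner_le_norm _ _
      _ = 2 * (|F (a ^ 2)| * a) * ‖w x‖ := by ring
      _ ≤ 2 * (K * (1 + a ^ p)) * ‖w x‖ := by
          have := hFK a (norm_nonneg _)
          have h0 := norm_nonneg (w x)
          gcongr ?_ * _
          exact mul_le_mul_of_nonneg_left this (by norm_num)
      _ ≤ 2 * (K * (1 + 2 ^ p * (‖v x‖ ^ p + D ^ p))) * ‖w x‖ := by gcongr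
      _ = _ := by ring
  · have h1 : HasDerivAt (fun t : ℝ ↦ (r₀ : ℂ) - (v x + t • w x)) (-w x) t := by
      simpa using ((hasDerivAt_id t).smul_const (w x)).const_add (v x) |>.const_sub (r₀ : ℂ)
    have h2 := (hasDerivAt_potential (r₀ := r₀) hF _).comp t h1.norm_sq
    refine h2.congr_deriv ?_
    rw [inner_neg_right]
    ring

lemma integrable_inner_of_memLp_two {α : Type*} [MeasurableSpace α] {μ : Measure α} {f g : α → ℂ}
    (hf : MemLp f 2 μ) (hg : MemLp g 2 μ) : Integrable (fun x ↦ inner ℝ (f x) (g x)) μ := by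
  have h1 : Integrable (fun x ↦ ‖f x‖ ^ 2) μ := by
    simpa using hf.integrable_norm_rpow two_ne_zero (by simp)
  have h2 : Integrable (fun x ↦ ‖g x‖ ^ 2) μ := by
    simpa using hg.integrable_norm_rpow two_ne_zero (by simp)
  refine (h1.add h2).mono' (hf.1.inner hg.1) (ae_of_all _ fun x ↦ ?_)
  refine (abs_real_inner_le_norm _ _).trans ?_
  simp only [Pi.add_apply]
  nlinarith [sq_nonneg (‖f x‖ - ‖g x‖), norm_nonneg (f x), norm_nonneg (g x)]

lemma hasDerivAt_quadratic (a b c : ℝ) :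
    HasDerivAt (fun t : ℝ ↦ a + (t * b + t ^ 2 * c)) b 0 := by
  have h1 : HasDerivAt (fun t : ℝ ↦ t * b) b 0 := by
    simpa using (hasDerivAt_id (0 : ℝ)).mul_const b
  have h2 : HasDerivAt (fun t : ℝ ↦ t ^ 2 * c) 0 0 := by
    simpa using ((hasDerivAt_id (0 : ℝ)).pow 2).mul_const c
  simpa using (h1.add h2).const_add a

lemma hasDerivAt_integral_norm_sq {α : Type*} [MeasurableSpace α] {μ : Measure α} {f g : α → ℂ}
    (hf : MemLp f 2 μ) (hg : MemLp g 2 μ) :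
    HasDerivAt (fun t : ℝ ↦ ∫ x, ‖f x + t • g x‖ ^ 2 ∂μ) (2 * ∫ x, inner ℝ (f x) (g x) ∂μ) 0 := by
  have h1 : Integrable (fun x ↦ ‖f x‖ ^ 2) μ := by
    simpa using hf.integrable_norm_rpow two_ne_zero (by simp)
  have h2 : Integrable (fun x ↦ ‖g x‖ ^ 2) μ := by
    simpa using hg.integrable_norm_rpow two_ne_zero (by simp)
  have h3 := integrable_inner_of_memLp_two hf hg
  have heq : ∀ t : ℝ, ∫ x, ‖f x + t • g x‖ ^ 2 ∂μ = (∫ x, ‖f x‖ ^ 2 ∂μ) +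
      (t * (2 * ∫ x, inner ℝ (f x) (g x) ∂μ) + t ^ 2 * ∫ x, ‖g x‖ ^ 2 ∂μ) := by
    intro t
    have : ∀ x, ‖f x + t • g x‖ ^ 2 =
        ‖f x‖ ^ 2 + (t * 2 * inner ℝ (f x) (g x) + t ^ 2 * ‖g x‖ ^ 2) := fun x ↦ by
      rw [norm_add_sq_real, inner_smul_right, norm_smul, mul_pow, Real.norm_eq_abs, sq_abs]
      ring
    simp_rw [this]
    rw [integral_add h1 (f := fun x ↦ ‖f x‖ ^ 2)
        (g := fun x ↦ t * 2 * inner ℝ (f x) (g x) + t ^ 2 * ‖g x‖ ^ 2)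
        ((h3.const_mul _).add (h2.const_mul _)),
      integral_add (h3.const_mul _) (h2.const_mul _), integral_const_mul, integral_const_mul,
      mul_assoc]
  simp_rw [heq]
  exact hasDerivAt_quadratic _ _ _

variable [NeZero N]

/-- The momentum is quadratic along segments in the directions of test functions. If the momentum
density is not in `L¹ + 𝒴`, it is constant by convention. -/
lemma exists_hasDerivAt_momentum (hN : 3 ≤ N) {g : Space N → ℂ} (hvg : IsWeakPartial 0 v g) :
    ∃ θ : ℝ, 0 ≤ θ ∧ θ ≤ 1 ∧ ∀ w : Space N → ℂ, ContDiff ℝ ∞ w → HasCompactSupport w →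
      HasDerivAt (fun t : ℝ ↦ momentum (v + t • w))
        (θ * ∫ x, (inner ℝ (Complex.I * g x) (w x) +
          inner ℝ (Complex.I * fderiv ℝ w x (EuclideanSpace.single 0 1)) (v x))) 0 := by
  set h₀ : Space N → ℝ := fun x ↦ inner ℝ (Complex.I * g x) (v x) with hh₀
  have key : ∀ w : Space N → ℂ, ContDiff ℝ ∞ w → HasCompactSupport w → ∃ k₁ k₂ : Space N → ℝ,
      (k₁ = fun x ↦ inner ℝ (Complex.I * g x) (w x) +
        inner ℝ (Complex.I * fderiv ℝ w x (EuclideanSpace.single 0 1)) (v x)) ∧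
      Integrable k₁ ∧ Integrable k₂ ∧ ∀ t : ℝ,
        (fun x ↦ inner ℝ (Complex.I * weakPartial 0 (v + t • w) x) ((v + t • w) x)) =ᵐ[volume]
          h₀ + fun x ↦ t * k₁ x + t ^ 2 * k₂ x := by
    intro w hw hwc
    set w₁ : Space N → ℂ := fun x ↦ fderiv ℝ w x (EuclideanSpace.single 0 1) with hw₁
    have hw₁c : Continuous w₁ := continuous_fderiv_single hw
    have hw₁s : HasCompactSupport w₁ := hasCompactSupport_fderiv_single hwc
    have hinner : ∀ (f k : Space N → ℂ), LocallyIntegrable f → Continuous k → HasCompactSupport k →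
        Integrable fun x ↦ inner ℝ (f x) (k x) := by
      intro f k hf hk hkc
      have h1 := hf.integrable_smul_left_of_hasCompactSupport hk.norm hkc.norm
      refine h1.norm.mono' (hf.aestronglyMeasurable.inner hk.aestronglyMeasurable)
        (ae_of_all _ fun x ↦ ?_)
      rw [norm_smul, norm_norm, mul_comm]
      exact abs_real_inner_le_norm _ _
    have hIg : LocallyIntegrable fun x ↦ Complex.I * g x := LocallyIntegrable.smul hvg.2.1 Complex.I
    refine ⟨_, fun x ↦ inner ℝ (Complex.I * w₁ x) (w x), rfl, ?_, ?_, fun t ↦ ?_⟩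
    · refine (hinner _ _ hIg hw.continuous hwc).add ?_
      simp_rw [real_inner_comm]
      exact hinner _ _ hvg.1 (continuous_const.mul hw₁c) hw₁s.mul_left
    · exact hinner _ _ (continuous_const.mul hw₁c).locallyIntegrable hw.continuous hwc
    · have hwp := (hvg.add ((isWeakPartial_fderiv (i := 0) hw).const_smul t)).weakPartial_ae_eq
      filter_upwards [hwp] with x hx
      rw [hx]
      simp only [Pi.add_apply, Pi.smul_apply, hh₀, mul_add, inner_add_left, inner_add_right,
        mul_smul_comm, inner_smul_left, inner_smul_right]
      simp
      ring
  -- The density along the segment differs from `h₀` by integrable terms, so it is in `L¹ + 𝒴` for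
  -- all `t` or for none: hence `θ = 1` or `θ = 0`.
  by_cases hdec : IsDecomposable h₀
  · refine ⟨1, zero_le_one, le_rfl, fun w hw hwc ↦ ?_⟩
    obtain ⟨k₁, k₂, hk₁, hi₁, hi₂, hk⟩ := key w hw hwc
    rw [← hk₁, one_mul]
    have heq : ∀ t : ℝ, momentum (v + t • w) =
        extendedIntegral h₀ + (t * (∫ x, k₁ x) + t ^ 2 * ∫ x, k₂ x) := by
      intro t
      rw [momentum, hdec.extendedIntegral_add hN ((hi₁.const_mul t).add (hi₂.const_mul (t ^ 2)))
        (hk t), integral_add' (hi₁.const_mul t) (hi₂.const_mul (t ^ 2)), integral_const_mul,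
        integral_const_mul]
    simp_rw [heq]
    exact hasDerivAt_quadratic _ _ _
  · refine ⟨0, le_rfl, zero_le_one, fun w hw hwc ↦ ?_⟩
    obtain ⟨k₁, k₂, hk₁, hi₁, hi₂, hk⟩ := key w hw hwc
    have heq : ∀ t : ℝ, momentum (v + t • w) = 0 := fun t ↦
      extendedIntegral_eq_zero_of_not hdec ((hi₁.const_mul t).add (hi₂.const_mul (t ^ 2))) (hk t)
    simp_rw [heq, zero_mul]
    exact hasDerivAt_const _ _

end EulerLagrange

/-! ### Critical points as distributional solutions -/

section CriticalPoint

variable {N : ℕ} {r₀ p K c : ℝ} {F : ℝ → ℝ} {v : Space N → ℂ}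

variable [NeZero N]

/-- Critical points of `B_c` solve the Euler-Lagrange equation in the sense of distributions. The
factor `θ` records the convention for the momentum in `exists_hasDerivAt_momentum`. -/
theorem exists_isWeakPartial_of_hasLineDerivAt (hN : 3 ≤ N) (hr₀ : 0 ≤ r₀) (hp : 0 ≤ p)
    (hK : 0 ≤ K) (hF : Continuous F) (hFK : ∀ a, 0 ≤ a → |F (a ^ 2)| * a ≤ K * (1 + a ^ p))
    (hv : MemD12 v) (hvp : Integrable fun x ↦ ‖v x‖ ^ p)
    (hV : Integrable fun x ↦ potential r₀ F (‖(r₀ : ℂ) - v x‖ ^ 2))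
    (hcrit : ∀ w : Space N → ℂ, ContDiff ℝ ∞ w → HasCompactSupport w →
      HasDerivAt (fun t : ℝ ↦ functionalB r₀ F c (v + t • w)) 0 0) :
    ∃ θ : ℝ, 0 ≤ θ ∧ θ ≤ 1 ∧ IsWeakPartial 0 (weakPartial 0 v) fun x ↦
      Complex.I * (c * θ : ℝ) * weakPartial 0 v x +
        F (‖(r₀ : ℂ) - v x‖ ^ 2) * (r₀ - v x) := by
  have hvg := hv.isWeakPartial_weakPartial 0
  have hg := hv.memLp_weakPartial 0
  set g := weakPartial 0 v with hgdef
  obtain ⟨θ, hθ0, hθ1, hmom⟩ := exists_hasDerivAt_momentum hN hvg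
  set f : Space N → ℂ := fun x ↦ F (‖(r₀ : ℂ) - v x‖ ^ 2) * (r₀ - v x) with hf
  have hfl : LocallyIntegrable f := locallyIntegrable_nonlinearity hr₀ hp hK hF hFK hv.1.1 hvp
  have hIg : LocallyIntegrable fun x ↦ Complex.I * (c * θ : ℝ) * g x :=
    LocallyIntegrable.smul hvg.2.1 (Complex.I * (c * θ : ℝ))
  refine ⟨θ, hθ0, hθ1, hvg.2.1, hIg.add hfl, fun ψ hψ hψc ↦ ?_⟩
  set dψ : Space N → ℝ := fun x ↦ fderiv ℝ ψ x (EuclideanSpace.single 0 1) with hdψ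
  have hdc : Continuous dψ := continuous_fderiv_single hψ
  have hds : HasCompactSupport dψ := hasCompactSupport_fderiv_single hψc
  have iA : Integrable fun x ↦ dψ x • g x :=
    hvg.2.1.integrable_smul_left_of_hasCompactSupport hdc hds
  have iB : Integrable fun x ↦ ψ x • g x :=
    hvg.2.1.integrable_smul_left_of_hasCompactSupport hψ.continuous hψc
  have iD : Integrable fun x ↦ ψ x • f x :=
    hfl.integrable_smul_left_of_hasCompactSupport hψ.continuous hψc
  have iE : Integrable fun x ↦ dψ x • v x :=
    hvg.1.integrable_smul_left_of_hasCompactSupport hdc hds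
  have hE := hvg.2.2 ψ hψ hψc
  set A := ∫ x, dψ x • g x with hA
  set B := ∫ x, ψ x • g x with hB
  set D := ∫ x, ψ x • f x with hD
  -- The variation `ψ z` with a constant `z` gives one real equation; letting `z` vary recovers the
  -- complex one.
  have key : ∀ z : ℂ, inner ℝ z (A + (Complex.I * (c * θ : ℝ) * B + D)) = 0 := by
    intro z
    set w : Space N → ℂ := fun x ↦ ψ x • z with hw
    have hws : ContDiff ℝ ∞ w := hψ.smul contDiff_const
    have hwc : HasCompactSupport w := hψc.smul_right
    have hdw : ∀ x, fderiv ℝ w x (EuclideanSpace.single 0 1) = dψ x • z := fun x ↦ by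
      rw [hw, fderiv_smul_const (hψ.differentiable (by simp) x)]
      rfl
    have hw2 : MemLp (fun x ↦ dψ x • z) 2 :=
      (hdc.smul continuous_const).memLp_of_hasCompactSupport hds.smul_right
    have h1 : HasDerivAt (fun t : ℝ ↦ ∫ x, ‖weakPartial 0 (v + t • w) x‖ ^ 2)
        (2 * ∫ x, inner ℝ (g x) (dψ x • z)) 0 := by
      have h2 := hasDerivAt_integral_norm_sq hg hw2
      refine h2.congr_of_eventuallyEq (Eventually.of_forall fun t ↦ integral_congr_ae ?_)
      filter_upwards [(hvg.add ((isWeakPartial_fderiv (i := 0) hws).const_smul t)).weakPartial_ae_eq]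
        with x hx
      simp only [hx, Pi.add_apply, Pi.smul_apply, hdw]
    have h3 := hasDerivAt_integral_potential hr₀ hp hK hF hFK hv.1.1 hvp hV hws.continuous hwc
    have h4 := ((h1.add ((hmom w hws hwc).const_mul c)).add h3).unique (hcrit w hws hwc)
    have e1 : ∫ x, inner ℝ (g x) (dψ x • z) = inner ℝ z A := by
      rw [hA, ← integral_inner iA]
      exact integral_congr_ae (ae_of_all _ fun x ↦ by
        simp only [inner_smul_right, real_inner_comm])
    have e2 : ∫ x, inner ℝ (Complex.I * g x) (w x) = inner ℝ z (Complex.I * B) := by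
      rw [hB, ← integral_const_mul, ← integral_inner (iB.const_mul _)]
      exact integral_congr_ae (ae_of_all _ fun x ↦ by
        simp only [hw, mul_smul_comm, inner_smul_right, real_inner_comm])
    -- Integrating by parts, the two terms of the derivative of the momentum coincide. All three
    -- parts of the functional thus carry the same factor `2`.
    have e3 : ∫ x, inner ℝ (Complex.I * fderiv ℝ w x (EuclideanSpace.single 0 1)) (v x) =
        inner ℝ z (Complex.I * B) := by
      have : inner ℝ z (Complex.I * B) = inner ℝ (Complex.I * z) (-B) := by
        simp only [Complex.inner, map_mul, Complex.conj_I]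
        simp
        ring
      rw [this, hB, ← hE, ← integral_inner iE]
      exact integral_congr_ae (ae_of_all _ fun x ↦ by
        simp only [hdw, mul_smul_comm, inner_smul_right, inner_smul_left]
        rfl)
    have e4 : ∫ x, 2 * (F (‖(r₀ : ℂ) - v x‖ ^ 2) * inner ℝ ((r₀ : ℂ) - v x) (w x)) =
        2 * inner ℝ z D := by
      rw [hD, ← integral_inner iD, ← integral_const_mul]
      refine integral_congr_ae (ae_of_all _ fun x ↦ ?_)
      simp only [hw, hf, inner_smul_right, ← Complex.real_smul, real_inner_comm z]
      ring
    have i2 : Integrable fun x ↦ inner ℝ (Complex.I * g x) (w x) :=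
      ((iB.const_mul Complex.I).const_inner (𝕜 := ℝ) z).congr (ae_of_all _ fun x ↦ by
        simp only [hw, mul_smul_comm, inner_smul_right, real_inner_comm])
    have i3 : Integrable fun x ↦
        inner ℝ (Complex.I * fderiv ℝ w x (EuclideanSpace.single 0 1)) (v x) :=
      (iE.const_inner (𝕜 := ℝ) (Complex.I * z)).congr (ae_of_all _ fun x ↦ by
        simp only [hdw, mul_smul_comm, inner_smul_right, inner_smul_left]
        rfl)
    rw [integral_add i2 i3, e1, e2, e3, e4] at h4
    have e5 : Complex.I * (c * θ : ℝ) * B = (c * θ) • (Complex.I * B) := by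
      rw [Complex.real_smul]; ring
    rw [e5, inner_add_right, inner_add_right, inner_smul_right]
    linarith
  have h0 := inner_self_eq_zero.1 (key (A + (Complex.I * (c * θ : ℝ) * B + D)))
  have h5 : ∫ x, ψ x • (Complex.I * (c * θ : ℝ) * g x + f x) =
      Complex.I * (c * θ : ℝ) * B + D := by
    rw [hB, hD, ← integral_const_mul, ← integral_add (iB.const_mul _) iD]
    exact integral_congr_ae (ae_of_all _ fun x ↦ by simp only [smul_add, mul_smul_comm])
  rw [h5]
  exact eq_neg_of_add_eq_zero_left h0

/-- A function of `𝒟^{1,2}` whose derivative in one direction vanishes is zero. -/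
lemma MemD12.ae_eq_zero (hN : 3 ≤ N) (hv : MemD12 v) (hg : weakPartial 0 v =ᵐ[volume] 0) :
    v =ᵐ[volume] 0 := by
  have hvp := integrable_norm_rpow_sobolev hN hv.1
  have hvg := hv.isWeakPartial_weakPartial 0
  have hp := two_lt_sobolev hN
  set p : ℝ := 2 * (N : ℝ) / ((N : ℝ) - 2)
  obtain ⟨n, rfl⟩ : ∃ n, N = n + 1 := ⟨N - 1, by omega⟩
  have h1 : ∀ᵐ y : Fin n → ℝ, ∫⁻ s, ‖v (slicePoint 0 (s, y))‖ₑ = 0 := by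
    filter_upwards [(hvg.congr_right hg).ae_exists_ae_eq_primitive, ae_integrable_slice hvp 0]
      with y ⟨k, hk⟩ h3
    have hk' : ∀ᵐ s, v (slicePoint 0 (s, y)) = k := hk.mono fun s hs ↦ by simpa using hs
    have h4 : Integrable fun _ : ℝ ↦ ‖k‖ ^ p := h3.congr (hk'.mono fun s hs ↦ by simp only [hs])
    rw [integrable_const_iff] at h4
    have hk0 : k = 0 := by
      rcases h4 with h4 | h4
      · rwa [Real.rpow_eq_zero (norm_nonneg _) (by linarith), norm_eq_zero] at h4
      · simpa using h4.measure_univ_lt_top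
    rw [lintegral_congr_ae (hk'.mono fun s hs ↦ by rw [hs, hk0, enorm_zero]), lintegral_zero]
  have h2 := lintegral_slicePoint 0 hv.1.1.enorm
  rw [lintegral_congr_ae h1, lintegral_zero, lintegral_eq_zero_iff' hv.1.1.enorm] at h2
  exact h2.mono fun x hx ↦ by simpa using hx

end CriticalPoint

end TravelingWaves

/-! ### Proof of the theorem -/

open TravelingWaves in
theorem lemma6p4 (N : ℕ) [NeZero N] (hN : 3 ≤ N)
    (r₀ : ℝ) (hr₀ : 0 < r₀)
    (F : ℝ → ℝ) (hA1 : TravelingWaves.AssumptionA1 r₀ F) (hA2 : TravelingWaves.AssumptionA2 N F)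
    (φ : ℝ → ℝ) (hφ : TravelingWaves.IsTruncation r₀ φ)
    (c : ℝ) (hc : 0 < c) (hcs : c < TravelingWaves.soundVelocity r₀ F)
    (v : TravelingWaves.Space N → ℂ) (hv : TravelingWaves.MemX r₀ φ v)
    (hcrit : ∀ w : TravelingWaves.Space N → ℂ, ContDiff ℝ 1 w → HasCompactSupport w →
      HasLineDerivAt ℝ (fun u : TravelingWaves.Space N → ℂ =>
        TravelingWaves.functionalB r₀ F c (v + u)) (0 : ℝ) 0 w) :
    v =ᵐ[volume] 0 := by
  -- `F` is only controlled on `[0, ∞)`. It is replaced by a continuous function on the line which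
  -- agrees with it there, without changing the functional.
  set E : ℝ → ℝ := fun s ↦ F (max s 0) with hE
  have hEF : ∀ s, 0 ≤ s → E s = F s := fun s hs ↦ by rw [hE]; simp only [max_eq_left hs]
  have hEc : Continuous E := by
    refine hA1.continuousOn.comp_continuous (continuous_id.max continuous_const) fun s ↦ ?_
    exact Set.mem_Ici.2 (le_max_right s 0)
  have hr2 : 0 < r₀ ^ 2 := by positivity
  have hE0 : E (r₀ ^ 2) = 0 := (hEF _ hr2.le).trans hA1.map_eq_zero
  have hE' : HasDerivAt E (deriv F (r₀ ^ 2)) (r₀ ^ 2) :=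
    (hA1.contDiffAt.differentiableAt one_ne_zero).hasDerivAt.congr_of_eventuallyEq
      ((lt_mem_nhds hr2).mono fun s (hs : 0 < s) ↦ hEF s hs.le)
  have hpot : ∀ s, 0 ≤ s → potential r₀ F s = potential r₀ E s := fun s hs ↦
    intervalIntegral.integral_congr fun τ hτ ↦ (hEF τ ((le_min hs hr2.le).trans hτ.1)).symm
  have hB : functionalB (N := N) r₀ F c = functionalB r₀ E c := by
    funext u
    simp only [functionalB, hpot _ (sq_nonneg _)]
  obtain ⟨C, hC, hFC⟩ := exists_abs_le_of_assumptionA2 hA1.continuousOn hA2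
  have hEC : ∀ s, 0 ≤ s → |E s| ≤ C * (1 + s ^ (2 / ((N : ℝ) - 2))) := fun s hs ↦ by
    rw [hEF s hs]
    exact hFC s hs
  obtain ⟨K, hK⟩ := exists_abs_potential_le hN hr₀ hφ hEc hE0 hE' hC hEC
  have hvp := integrable_norm_rpow_sobolev hN hv.1.1
  have hV : Integrable fun x ↦ potential r₀ E (‖(r₀ : ℂ) - v x‖ ^ 2) :=
    ((hv.2.integrable_sq.add hvp).const_mul K).mono'
      ((continuous_potential hEc).comp_aestronglyMeasurable
        ((aestronglyMeasurable_const.sub hv.1.1.1).norm.pow 2)) (ae_of_all _ fun x ↦ hK (v x))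
  obtain ⟨θ, hθ0, hθ1, hEL⟩ := exists_isWeakPartial_of_hasLineDerivAt (c := c) hN hr₀.le
    (by linarith [two_lt_sobolev hN]) (by positivity) hEc (fun a ha ↦ exists_abs_mul_le hN hC hEC ha)
    hv.1 hvp hV fun w hw hwc ↦ by
      have := hcrit w (hw.of_le (by simp)) hwc
      rw [HasLineDerivAt, hB] at this
      simpa using this
  -- The right side is `v_s²`.
  have hcθ : (c * θ) ^ 2 < -2 * deriv F (r₀ ^ 2) * r₀ ^ 2 := by
    have h1 : c * θ ≤ c := mul_le_of_le_one_right hc.le hθ1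
    have h2 : 0 ≤ c * θ := mul_nonneg hc.le hθ0
    have h3 : c ^ 2 < soundVelocity r₀ F ^ 2 := by gcongr
    rw [soundVelocity, mul_pow, mul_pow,
      Real.sq_sqrt (by linarith [hA1.deriv_neg])] at h3
    nlinarith
  obtain ⟨l, hl0, hl⟩ := exists_sq_lt_potential hr₀ hEc hE0 hE' hcθ
  refine hv.1.ae_eq_zero hN ?_
  -- A transverse direction is needed besides `x₁`.
  obtain ⟨m, rfl⟩ : ∃ m, N = m + 2 := ⟨N - 2, by omega⟩
  exact ae_eq_zero_of_isWeakPartial hφ hr₀ hEc hl0 hl (hv.1.isWeakPartial_weakPartial 0)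
    (hv.1.memLp_weakPartial 0) (hv.1.isWeakPartial_weakPartial 1) (hv.1.memLp_weakPartial 1) hv.2 hEL
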